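/- Let $Q\subset\mathbb R^d$ be a convex polytope, $\phi:Q\to[0,1]$ a measurable density (the uncertainty density $\phi_n$ at a fixed step $n$), $k\in(0,1)$, $\alpha>0$, and $\beta(r)=1-ke^{-\alpha r^2}$. A configuration of $N$ robots is a tuple $\mathcal P=(p_1,\dots,p_N)\in Q^N$ with $p_i\ne p_j$ for $i\neq j$. Let $$V_i=V_i(\mathcal P)=\{q\in Q:\ \|q-p_i\|\le\|q-p_j\|\ \text{ for all } j\}$$ be its Voronoi cells, $$\mathcal H_n(\mathcal P)=\sum_{i=1}^N\int_{V_i}\phi(q)\bigl(1-\beta(\|p_i-q\|)\bigr)\,dq$$ the objective function (defined by the same formula for all $\mathcal P\in(\mathbb R^d)^N$), and let $$\tilde M_{V_i}=\int_{V_i}\phi(q)ke^{-\alpha\|p_i-q\|^2}dq,\qquad \tilde C_{V_i}=\frac1{\tilde M_{V_i}}\int_{V_i}q\,\phi(q)ke^{-\alpha\|p_i-q\|^2}dq$$ be the mass and the centroid of $V_i$ for the perceived density $\tilde\phi(q)=\phi(q)ke^{-\alpha\|p_i-q\|^2}$. Assume that the centroids are well defined, i.e. that $\tilde M_{V_i}(\mathcal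 P)>0$ for every configuration $\mathcal P$ and every $i$ (for instance, $Q$ has nonempty interior and $\phi>0$ almost everywhere on $Q$). Let $U_1,\dots,U_N>0$ and $\delta>0$, and consider the constant-speed control law $\dot p_i=u_i(\mathcal P)$, where $$u_i=\begin{cases}-U_i\,\dfrac{p_i-\tilde C_{V_i}}{\|p_i-\tilde C_{V_i}\|}&\text{if }\|p_i-\tilde C_{V_i}\|\ge\delta,\\[2mm]-U_i\,(p_i-\tilde C_{V_i})/\delta&\text{otherwise.}\end{cases}$$ Then the configurations that are critical points of $\mathcal H_n$ are exactly the centroidal Voronoi configurations for the perceived density, i.e. the configurations with $p_i=\tilde C_{V_i}(\mathcal P)$ for all $i$; and every trajectory $\mathcal P(t)$, $t\ge0$, of the control law that starts from a configuration $\mathcal P(0)\in Q^N$ of distinct points converges asymptotically to this set of critical points: the distance from $\mathcal P(t)$ to it tends to $0$ as $t\to\infty$. -/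

import Mathlib

open Set Filter Topology MeasureTheory

noncomputable section

/-- `Pt d` is the Euclidean space `ℝ^d`. -/
abbrev Pt (d : ℕ) : Type := EuclideanSpace ℝ (Fin d)

/-- A tuple of positions of `N` robots in `ℝ^d`. -/
abbrev Robots (N d : ℕ) : Type := Fin N → Pt d

/-- A convex polytope: the convex hull of finitely many points. -/
def IsConvexPolytope {d : ℕ} (Q : Set (Pt d)) : Prop :=
  ∃ s : Finset (Pt d), Q = convexHull ℝ (s : Set (Pt d))

/-- The configurations of `N` robots in `Q`: tuples of pairwise distinct points of `Q`. -/
def configSpace {d : ℕ} (N : ℕ) (Q : Set (Pt d)) : Set (Robots N d) :=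
  {P | (∀ i, P i ∈ Q) ∧ ∀ i j, i ≠ j → P i ≠ P j}

/-- The Voronoi cell of the `i`-th robot in `Q`. -/
def voronoiCell {N d : ℕ} (Q : Set (Pt d)) (P : Robots N d) (i : Fin N) : Set (Pt d) :=
  {q | q ∈ Q ∧ ∀ j, ‖q - P i‖ ≤ ‖q - P j‖}

/-- The search effectiveness function `β(r) = 1 - k exp(-α r²)`. -/
def searchBeta (k α r : ℝ) : ℝ := 1 - k * Real.exp (-α * r ^ 2)

/-- The objective function `∑ i, ∫_{V_i} φ(q) (1 - β(‖p_i - q‖)) dq`. -/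
def searchObjective {N d : ℕ} (Q : Set (Pt d)) (φ : Pt d → ℝ) (k α : ℝ) (P : Robots N d) : ℝ :=
  ∑ i, ∫ q in voronoiCell Q P i, φ q * (1 - searchBeta k α ‖P i - q‖)

/-- The density as perceived by a robot at `p`: `φ(q) k exp(-α ‖p - q‖²)`. -/
def perceivedDensity {d : ℕ} (φ : Pt d → ℝ) (k α : ℝ) (p q : Pt d) : ℝ :=
  φ q * (k * Real.exp (-α * ‖p - q‖ ^ 2))

/-- The mass of the `i`-th Voronoi cell for the density perceived by the `i`-th robot. -/
def perceivedMass {N d : ℕ} (Q : Set (Pt d)) (φ : Pt d → ℝ) (k α : ℝ)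
    (P : Robots N d) (i : Fin N) : ℝ :=
  ∫ q in voronoiCell Q P i, perceivedDensity φ k α (P i) q

/-- The centroid of the `i`-th Voronoi cell for the density perceived by the `i`-th robot. -/
def perceivedCentroid {N d : ℕ} (Q : Set (Pt d)) (φ : Pt d → ℝ) (k α : ℝ)
    (P : Robots N d) (i : Fin N) : Pt d :=
  (perceivedMass Q φ k α P i)⁻¹ •
    ∫ q in voronoiCell Q P i, perceivedDensity φ k α (P i) q • q

open Classical in
/-- The constant-speed control law: robot `i` moves toward the centroid of its cell with speed
`U i` while at distance at least `δ` from it, and with linearly decreasing speed otherwise. -/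
def constSpeedControl {N d : ℕ} (Q : Set (Pt d)) (φ : Pt d → ℝ) (k α : ℝ)
    (U : Fin N → ℝ) (δ : ℝ) (P : Robots N d) (i : Fin N) : Pt d :=
  if δ ≤ ‖P i - perceivedCentroid Q φ k α P i‖ then
    -(U i / ‖P i - perceivedCentroid Q φ k α P i‖) • (P i - perceivedCentroid Q φ k α P i)
  else
    -(U i / δ) • (P i - perceivedCentroid Q φ k α P i)

/-- `P` solves `dp_i/dt = u_i(P)` for all times `t ≥ 0` (one-sided derivative at `t = 0`). -/
def IsTrajectory {N d : ℕ} (u : Robots N d → Fin N → Pt d) (P : ℝ → Robots N d) : Prop :=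
  ∀ t, 0 ≤ t → ∀ i, HasDerivWithinAt (fun τ => P τ i) (u (P t) i) (Ici 0) t

/-- The configurations in `Q` that are critical points of `H`. -/
def criticalConfigs {N d : ℕ} (Q : Set (Pt d)) (H : Robots N d → ℝ) : Set (Robots N d) :=
  {P | P ∈ configSpace N Q ∧ HasFDerivAt H (0 : Robots N d →L[ℝ] ℝ) P}

/-- The centroidal Voronoi configurations for the perceived density. -/
def centroidalConfigs {d : ℕ} (N : ℕ) (Q : Set (Pt d)) (φ : Pt d → ℝ) (k α : ℝ) :
    Set (Robots N d) :=
  {P | P ∈ configSpace N Q ∧ ∀ i, P i = perceivedCentroid Q φ k α P i}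

end

/-! For distinct points the objective equals `∫ q in Q, φ q * max_i k exp(-α ‖p_i - q‖²)`, since the
nearest robot gives the strongest signal and bisectors are null sets. The integrand is uniformly
Lipschitz in the configuration and, for almost every `q`, differentiable, so one differentiates
under the integral and no boundary terms of moving cells arise (`hasFDerivAt_searchObjective`). The
`i`-th partial gradient is `2α` times the first moment of the cell about `p_i`, that is `2α M_i (C_i
- p_i)`; it vanishes exactly when `p_i = C_i`.

Each velocity is a positive multiple of `C_i - p_i`, so the objective increases along trajectories,
at a rate bounded below by squared moments. It is bounded, and a LaSalle-type argument would finish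
if the configuration space were compact. It is not, because robots may approach each other; two
facts repair this. In finite time there is no collision: `C_i` stays on the `i` side of each
bisector, so distances shrink at most exponentially (`IsTrajectory.mem_configSpace`). In the limit,
configurations whose moments tend to zero cannot accumulate at a collision (`pairwise_ne_of_limit`):
along a subsequence the unit normals of the bisectors converge, every cell tends to a limit cell,
and a zero moment about a point on the boundary hyperplane of its cell forces `φ = 0` almost
everywhere there, against positivity of masses. Hence the rate of increase is bounded below away
from the centroidal set, while speeds are bounded, so a trajectory cannot be far from that set at
arbitrarily late times. -/

/-! ### Voronoi cells as intersections of half-spaces; masses, moments and centroids -/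

section Cells

variable {N d : ℕ} {Q : Set (Pt d)} {φ : Pt d → ℝ} {k α : ℝ}

/-- The part of `Q` cut out by the half-spaces with inner normals `e i j` through the midpoints
of `P i` and `P j`. -/
def halfspaceCell (Q : Set (Pt d)) (P : Robots N d) (e : Fin N → Fin N → Pt d) (i : Fin N) :
    Set (Pt d) :=
  {q | q ∈ Q ∧ ∀ j, j ≠ i → 0 ≤ inner ℝ (q - (2⁻¹ : ℝ) • (P i + P j)) (e i j)}

/-- The first moment of the `i`-th cell about the `i`-th robot, for the perceived density. -/
noncomputable def perceivedMoment (Q : Set (Pt d)) (φ : Pt d → ℝ) (k α : ℝ)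
    (P : Robots N d) (i : Fin N) : Pt d :=
  ∫ q in voronoiCell Q P i, perceivedDensity φ k α (P i) q • (q - P i)

lemma inner_sub_midpoint_sub (q a b : Pt d) :
    inner ℝ (q - (2⁻¹ : ℝ) • (a + b)) (a - b) = (‖q - b‖ ^ 2 - ‖q - a‖ ^ 2) / 2 := by
  have h1 : q - (2⁻¹ : ℝ) • (a + b) = (2⁻¹ : ℝ) • ((q - b) + (q - a)) := by module
  have h2 : a - b = (q - b) - (q - a) := by abel
  rw [h1, h2, real_inner_smul_left, inner_add_left, inner_sub_right (q - b) (q - b),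
    inner_sub_right (q - a) (q - b), real_inner_self_eq_norm_sq, real_inner_self_eq_norm_sq, real_inner_comm (q - a) (q - b)]
  ring

lemma norm_sub_le_iff_inner (q a b : Pt d) :
    ‖q - a‖ ≤ ‖q - b‖ ↔ 0 ≤ inner ℝ (q - (2⁻¹ : ℝ) • (a + b)) (a - b) := by
  rw [inner_sub_midpoint_sub, ← sq_le_sq₀ (norm_nonneg _) (norm_nonneg _)]
  constructor <;> intro h <;> linarith

/-- Only the direction of `P i - P j` matters, so the normals may be rescaled to unit length; unlike
the differences, unit normals do not degenerate when robots merge. -/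
lemma voronoiCell_eq_halfspaceCell (Q : Set (Pt d)) (P : Robots N d)
    (e : Fin N → Fin N → Pt d) (i : Fin N)
    (he : ∀ j, j ≠ i → ∃ c : ℝ, 0 < c ∧ P i - P j = c • e i j) :
    voronoiCell Q P i = halfspaceCell Q P e i := by
  ext q
  refine and_congr_right fun _ => forall_congr' fun j => ?_
  by_cases hj : j = i
  · simp [hj]
  · obtain ⟨c, hc, h⟩ := he j hj
    rw [norm_sub_le_iff_inner, h, real_inner_smul_right, mul_nonneg_iff_of_pos_left hc]
    simp [hj]

lemma isClosed_halfspaceCell (hQ : IsClosed Q) (P : Robots N d) (e : Fin N → Fin N → Pt d)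
    (i : Fin N) : IsClosed (halfspaceCell Q P e i) := by
  simp only [halfspaceCell, ofPred_and, ofPred_forall]
  refine hQ.inter (isClosed_iInter fun j => isClosed_iInter fun _ => ?_)
  exact isClosed_le continuous_const (by fun_prop)

lemma isClosed_voronoiCell (hQ : IsClosed Q) (P : Robots N d) (i : Fin N) :
    IsClosed (voronoiCell Q P i) := by
  simp only [voronoiCell, ofPred_and, ofPred_forall]
  refine hQ.inter (isClosed_iInter fun j => ?_)
  exact isClosed_le (by fun_prop) (by fun_prop)

lemma voronoiCell_subset (Q : Set (Pt d)) (P : Robots N d) (i : Fin N) :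
    voronoiCell Q P i ⊆ Q := fun _ h => h.1

lemma volume_hyperplane (m : Pt d) {e : Pt d} (he : e ≠ 0) :
    volume {q : Pt d | inner ℝ (q - m) e = 0} = 0 := by
  have h : {q : Pt d | inner ℝ (q - m) e = 0}
      = (fun q => q - m) ⁻¹' (((ℝ ∙ e)ᗮ : Submodule ℝ (Pt d)) : Set (Pt d)) := by
    ext q
    simp [Submodule.mem_orthogonal_singleton_iff_inner_left]
  simp only [sub_eq_add_neg] at h
  simp only [sub_eq_add_neg]
  rw [h, measure_preimage_add_right]
  refine Measure.addHaar_submodule _ _ fun htop => he ?_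
  have : e ∈ (ℝ ∙ e)ᗮ := htop ▸ Submodule.mem_top
  rw [Submodule.mem_orthogonal_singleton_iff_inner_left] at this
  exact inner_self_eq_zero.1 this

lemma ae_inner_ne_zero (s : Set (Pt d)) (m : Pt d) {e : Pt d} (he : e ≠ 0) :
    ∀ᵐ q ∂(volume.restrict s), inner ℝ (q - m) e ≠ 0 := by
  refine ae_restrict_of_ae ?_
  rw [ae_iff]
  simpa using volume_hyperplane m he

lemma ae_norm_sub_ne (s : Set (Pt d)) {a b : Pt d} (h : a ≠ b) :
    ∀ᵐ q ∂(volume.restrict s), ‖q - a‖ ≠ ‖q - b‖ := by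
  filter_upwards [ae_inner_ne_zero s ((2⁻¹ : ℝ) • (a + b)) (sub_ne_zero.2 h)] with q hq h'
  apply hq
  rw [inner_sub_midpoint_sub, h']
  simp

lemma aestronglyMeasurable_density_smul {E : Type*} [NormedAddCommGroup E] [NormedSpace ℝ E]
    (hφm : AEMeasurable φ (volume.restrict Q)) {G : Pt d → E} (hG : Continuous G) :
    AEStronglyMeasurable (fun q => φ q • G q) (volume.restrict Q) :=
  hφm.aestronglyMeasurable.smul hG.aestronglyMeasurable

lemma integrableOn_density_smul {E : Type*} [NormedAddCommGroup E] [NormedSpace ℝ E]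
    (hQ : IsCompact Q) (hφm : AEMeasurable φ (volume.restrict Q))
    (hφ : ∀ q ∈ Q, φ q ∈ Icc (0 : ℝ) 1) {G : Pt d → E} (hG : Continuous G) :
    IntegrableOn (fun q => φ q • G q) Q := by
  obtain ⟨C, hC⟩ := hQ.exists_bound_of_continuousOn hG.continuousOn
  refine IntegrableOn.of_bound hQ.measure_lt_top (aestronglyMeasurable_density_smul hφm hG) C ?_
  filter_upwards [ae_restrict_mem hQ.measurableSet] with q hq
  rw [norm_smul, Real.norm_of_nonneg (hφ q hq).1]
  exact (mul_le_of_le_one_left (norm_nonneg _) (hφ q hq).2).trans (hC q hq)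

/-- Dominated convergence: almost every `q` lies off all the limiting hyperplanes, so its membership
in the cell is locally constant. Positions and normals vary independently and only the normals must
be nonzero, which permits collisions in `P`. -/
lemma continuousAt_integral_halfspaceCell {E : Type*} [NormedAddCommGroup E] [NormedSpace ℝ E]
    (hQ : IsCompact Q) (hφm : AEMeasurable φ (volume.restrict Q))
    (hφ : ∀ q ∈ Q, φ q ∈ Icc (0 : ℝ) 1) {G : Pt d × Pt d → E} (hG : Continuous G)
    (P : Robots N d) (e : Fin N → Fin N → Pt d) (i : Fin N) (he : ∀ j, j ≠ i → e i j ≠ 0) :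
    ContinuousAt (fun x : Robots N d × (Fin N → Fin N → Pt d) =>
      ∫ q in halfspaceCell Q x.1 x.2 i, φ q • G (x.1 i, q)) (P, e) := by
  have hrw : ∀ x : Robots N d × (Fin N → Fin N → Pt d),
      ∫ q in halfspaceCell Q x.1 x.2 i, φ q • G (x.1 i, q)
        = ∫ q in Q, (halfspaceCell Q x.1 x.2 i).indicator (fun q => φ q • G (x.1 i, q)) q := by
    intro x
    rw [setIntegral_indicator (isClosed_halfspaceCell hQ.isClosed _ _ _).measurableSet,
      inter_eq_self_of_subset_right fun q hq => hq.1]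
  simp only [hrw]
  obtain ⟨C, hC⟩ := ((isCompact_closedBall (P i) 1).prod hQ).exists_bound_of_continuousOn
    hG.continuousOn
  have hnear : ∀ᶠ x : Robots N d × (Fin N → Fin N → Pt d) in 𝓝 (P, e),
      x.1 i ∈ Metric.closedBall (P i) 1 := by
    have hc : ContinuousAt (fun x : Robots N d × (Fin N → Fin N → Pt d) => x.1 i) (P, e) := by
      fun_prop
    exact hc (Metric.closedBall_mem_nhds _ one_pos)
  refine continuousAt_of_dominated (bound := fun _ => C) ?_ ?_ ?_ ?_
  · refine Eventually.of_forall fun x => ?_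
    exact (aestronglyMeasurable_density_smul hφm (by fun_prop)).indicator
      (isClosed_halfspaceCell hQ.isClosed _ _ _).measurableSet
  · filter_upwards [hnear] with x hx
    filter_upwards [ae_restrict_mem hQ.measurableSet] with q hq
    refine (norm_indicator_le_norm_self _ _).trans ?_
    rw [norm_smul, Real.norm_of_nonneg (hφ q hq).1]
    exact (mul_le_of_le_one_left (norm_nonneg _) (hφ q hq).2).trans (hC _ ⟨hx, hq⟩)
  · exact integrableOn_const hQ.measure_lt_top.ne
  · have hne : ∀ᵐ q ∂(volume.restrict Q), ∀ j, j ≠ i →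
        inner ℝ (q - (2⁻¹ : ℝ) • (P i + P j)) (e i j) ≠ 0 := by
      rw [ae_all_iff]
      intro j
      by_cases hj : j = i
      · simp [hj]
      · filter_upwards [ae_inner_ne_zero Q ((2⁻¹ : ℝ) • (P i + P j)) (he j hj)] with q hq _
        exact hq
    filter_upwards [hne, ae_restrict_mem hQ.measurableSet] with q hq hqQ
    have hcont : ∀ j, ContinuousAt (fun x : Robots N d × (Fin N → Fin N → Pt d) =>
        (inner ℝ (q - (2⁻¹ : ℝ) • (x.1 i + x.1 j)) (x.2 i j) : ℝ)) (P, e) := by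
      intro j
      fun_prop
    by_cases hmem : q ∈ halfspaceCell Q P e i
    · have hev : ∀ᶠ x : Robots N d × (Fin N → Fin N → Pt d) in 𝓝 (P, e),
          ∀ j, j ≠ i → 0 < (inner ℝ (q - (2⁻¹ : ℝ) • (x.1 i + x.1 j)) (x.2 i j) : ℝ) := by
        rw [eventually_all]
        intro j
        by_cases hj : j = i
        · simp [hj]
        · filter_upwards [(hcont j).eventually_const_lt
            (lt_of_le_of_ne (hmem.2 j hj) (hq j hj).symm)] with x hx _
          exact hx
      have hcG : ContinuousAt (fun x : Robots N d × (Fin N → Fin N → Pt d) =>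
          φ q • G (x.1 i, q)) (P, e) := by fun_prop
      refine hcG.congr ?_
      filter_upwards [hev] with x hx
      have hm : q ∈ halfspaceCell Q x.1 x.2 i := ⟨hqQ, fun j hj => (hx j hj).le⟩
      rw [indicator_of_mem hm]
    · have : ∃ j, j ≠ i ∧ inner ℝ (q - (2⁻¹ : ℝ) • (P i + P j)) (e i j) < 0 := by
        by_contra! hcon
        exact hmem ⟨hqQ, hcon⟩
      obtain ⟨j, hj, hlt⟩ := this
      have h0 : ContinuousAt (fun _ : Robots N d × (Fin N → Fin N → Pt d) => (0 : E)) (P, e) :=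
        continuousAt_const
      refine h0.congr ?_
      filter_upwards [(hcont j).eventually_lt_const hlt] with x hx
      have hm : q ∉ halfspaceCell Q x.1 x.2 i := fun hm => absurd (hm.2 j hj) (not_le.2 hx)
      rw [indicator_of_notMem hm]

lemma perceivedMass_eq (P : Robots N d) (i : Fin N) :
    perceivedMass Q φ k α P i
      = ∫ q in voronoiCell Q P i, φ q • (k * Real.exp (-α * ‖P i - q‖ ^ 2)) := rfl

lemma perceivedMoment_eq (P : Robots N d) (i : Fin N) :
    perceivedMoment Q φ k α P i
      = ∫ q in voronoiCell Q P i,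
          φ q • ((k * Real.exp (-α * ‖P i - q‖ ^ 2)) • (q - P i)) := by
  simp only [perceivedMoment, perceivedDensity, mul_smul]

lemma continuousAt_perceivedMass (hQ : IsCompact Q) (hφm : AEMeasurable φ (volume.restrict Q))
    (hφ : ∀ q ∈ Q, φ q ∈ Icc (0 : ℝ) 1) {P : Robots N d} (hP : ∀ i j, i ≠ j → P i ≠ P j)
    (i : Fin N) : ContinuousAt (fun P : Robots N d => perceivedMass Q φ k α P i) P := by
  have h := continuousAt_integral_halfspaceCell hQ hφm hφ
    (G := fun x : Pt d × Pt d => k * Real.exp (-α * ‖x.1 - x.2‖ ^ 2)) (by fun_prop) P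
    (fun i j => P i - P j) i (fun j hj => sub_ne_zero.2 (hP i j hj.symm))
  have h2 : ContinuousAt (fun P : Robots N d => (P, fun i j => P i - P j)) P := by fun_prop
  refine (ContinuousAt.comp (f := fun P : Robots N d => (P, fun i j => P i - P j)) h h2).congr ?_
  refine Eventually.of_forall fun P' => ?_
  simp only [Function.comp, perceivedMass_eq]
  rw [← voronoiCell_eq_halfspaceCell]
  exact fun j _ => ⟨1, one_pos, by simp⟩

lemma perceivedMoment_eq_smul (hQ : IsCompact Q) (hφm : AEMeasurable φ (volume.restrict Q))
    (hφ : ∀ q ∈ Q, φ q ∈ Icc (0 : ℝ) 1) {P : Robots N d} {i : Fin N}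
    (hm : 0 < perceivedMass Q φ k α P i) :
    perceivedMoment Q φ k α P i
      = perceivedMass Q φ k α P i • (perceivedCentroid Q φ k α P i - P i) := by
  rw [smul_sub, perceivedCentroid, smul_inv_smul₀ hm.ne', perceivedMoment]
  simp only [smul_sub]
  rw [integral_sub, integral_smul_const, ← perceivedMass]
  · have := (integrableOn_density_smul hQ hφm hφ
      (G := fun q => (k * Real.exp (-α * ‖P i - q‖ ^ 2)) • q) (by fun_prop)).mono_set
      (voronoiCell_subset Q P i)
    simpa only [perceivedDensity, mul_smul, IntegrableOn] using this
  · have := (integrableOn_density_smul hQ hφm hφ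
      (G := fun q => (k * Real.exp (-α * ‖P i - q‖ ^ 2)) • P i) (by fun_prop)).mono_set
      (voronoiCell_subset Q P i)
    simpa only [perceivedDensity, mul_smul, IntegrableOn] using this

/-- The centroid is a weighted average over the cell, so it lies in each closed half-space
containing the cell. This is used with half-spaces containing `Q` and with those bounded by
bisectors. -/
lemma inner_perceivedCentroid_le (hQ : IsCompact Q) (hφm : AEMeasurable φ (volume.restrict Q))
    (hφ : ∀ q ∈ Q, φ q ∈ Icc (0 : ℝ) 1) (hk : 0 ≤ k) {P : Robots N d} {i : Fin N}
    (hm : 0 < perceivedMass Q φ k α P i) (f : Pt d →L[ℝ] ℝ) {b : ℝ}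
    (hf : ∀ q ∈ voronoiCell Q P i, f q ≤ b) : f (perceivedCentroid Q φ k α P i) ≤ b := by
  have hint1 : IntegrableOn (fun q => perceivedDensity φ k α (P i) q • q)
      (voronoiCell Q P i) := by
    have := (integrableOn_density_smul hQ hφm hφ
      (G := fun q => (k * Real.exp (-α * ‖P i - q‖ ^ 2)) • q) (by fun_prop)).mono_set
      (voronoiCell_subset Q P i)
    simpa only [perceivedDensity, mul_smul] using this
  have hint2 : IntegrableOn (fun q => perceivedDensity φ k α (P i) q * b)
      (voronoiCell Q P i) := by
    have := (integrableOn_density_smul hQ hφm hφ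
      (G := fun q => (k * Real.exp (-α * ‖P i - q‖ ^ 2)) * b) (by fun_prop)).mono_set
      (voronoiCell_subset Q P i)
    simpa only [perceivedDensity, mul_assoc, smul_eq_mul] using this
  rw [perceivedCentroid, map_smul, smul_eq_mul, inv_mul_le_iff₀ hm,
    ← ContinuousLinearMap.integral_comp_comm _ hint1, perceivedMass, ← integral_mul_const]
  refine setIntegral_mono_on (f.integrable_comp hint1) hint2
    (isClosed_voronoiCell hQ.isClosed P i).measurableSet fun q hq => ?_
  rw [map_smul, smul_eq_mul]
  refine mul_le_mul_of_nonneg_left (hf q hq) ?_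
  have := (hφ q hq.1).1
  unfold perceivedDensity
  positivity

lemma perceivedMass_le (hQ : IsCompact Q) (hφm : AEMeasurable φ (volume.restrict Q))
    (hφ : ∀ q ∈ Q, φ q ∈ Icc (0 : ℝ) 1) (hk : k ∈ Ioo (0 : ℝ) 1) (hα : 0 < α)
    (P : Robots N d) (i : Fin N) : perceivedMass Q φ k α P i ≤ volume.real Q := by
  have h1 : perceivedMass Q φ k α P i ≤ ∫ q in voronoiCell Q P i, (1 : ℝ) := by
    refine setIntegral_mono_on ?_ (integrableOn_const
      ((measure_mono (voronoiCell_subset Q P i)).trans_lt hQ.measure_lt_top).ne)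
      (isClosed_voronoiCell hQ.isClosed P i).measurableSet fun q hq => ?_
    · exact (integrableOn_density_smul hQ hφm hφ
        (G := fun q => k * Real.exp (-α * ‖P i - q‖ ^ 2)) (by fun_prop)).mono_set
        (voronoiCell_subset Q P i)
    · have h2 : Real.exp (-α * ‖P i - q‖ ^ 2) ≤ 1 := by
        rw [Real.exp_le_one_iff]
        nlinarith [sq_nonneg ‖P i - q‖]
      exact mul_le_one₀ (hφ q hq.1).2 (mul_nonneg hk.1.le (Real.exp_pos _).le)
        (mul_le_one₀ hk.2.le (Real.exp_pos _).le h2)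
  refine h1.trans ?_
  rw [setIntegral_const, smul_eq_mul, mul_one]
  exact measureReal_mono (voronoiCell_subset Q P i) hQ.measure_lt_top.ne

end Cells

/-! ### The objective as an integral of a maximum, its gradient and critical points -/

section Objective

variable {N d : ℕ} {Q : Set (Pt d)} {φ : Pt d → ℝ} {k α : ℝ}

lemma hasFDerivAt_gaussian (k α : ℝ) (p q : Pt d) :
    HasFDerivAt (fun p : Pt d => k * Real.exp (-α * ‖p - q‖ ^ 2))
      ((2 * α * (k * Real.exp (-α * ‖p - q‖ ^ 2))) • innerSL ℝ (q - p)) p := by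
  have h := ((((hasFDerivAt_id p).sub_const q).norm_sq.const_mul (-α)).exp).const_mul k
  refine h.congr_fderiv ?_
  ext v
  simp
  ring

/-- From `2r ≤ 1 + r²` and `x exp(-x) ≤ 1`; this gives the Lipschitz constant of the Gaussian
signal. -/
lemma two_mul_mul_exp_le {α r : ℝ} (hα : 0 < α) :
    2 * α * r * Real.exp (-α * r ^ 2) ≤ α + 1 := by
  have h1 : Real.exp (-α * r ^ 2) ≤ 1 := by
    rw [Real.exp_le_one_iff]
    nlinarith [sq_nonneg r]
  have h2 : α * r ^ 2 * Real.exp (-α * r ^ 2) ≤ 1 := by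
    have h3 : α * r ^ 2 ≤ Real.exp (α * r ^ 2) := by
      linarith [Real.add_one_le_exp (α * r ^ 2)]
    rw [neg_mul, Real.exp_neg, ← div_eq_mul_inv, div_le_one (Real.exp_pos _)]
    exact h3
  have h4 : 2 * α * r ≤ α + α * r ^ 2 := by nlinarith [mul_nonneg hα.le (sq_nonneg (r - 1))]
  calc 2 * α * r * Real.exp (-α * r ^ 2)
      ≤ (α + α * r ^ 2) * Real.exp (-α * r ^ 2) :=
        mul_le_mul_of_nonneg_right h4 (Real.exp_pos _).le
    _ = α * Real.exp (-α * r ^ 2) + α * r ^ 2 * Real.exp (-α * r ^ 2) := by ring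
    _ ≤ α + 1 := add_le_add (mul_le_of_le_one_right hα.le h1) h2

lemma abs_gaussian_sub_le (hk : k ∈ Ioo (0 : ℝ) 1) (hα : 0 < α) (p p' q : Pt d) :
    |k * Real.exp (-α * ‖p - q‖ ^ 2) - k * Real.exp (-α * ‖p' - q‖ ^ 2)|
      ≤ (α + 1) * ‖p - p'‖ := by
  refine Convex.norm_image_sub_le_of_norm_hasFDerivWithin_le (𝕜 := ℝ) (s := univ)
    (f := fun p : Pt d => k * Real.exp (-α * ‖p - q‖ ^ 2))
    (fun p _ => (hasFDerivAt_gaussian k α p q).hasFDerivWithinAt) (fun p _ => ?_)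
    convex_univ (mem_univ _) (mem_univ _)
  rw [norm_smul, innerSL_apply_norm, norm_sub_rev q p,
    Real.norm_of_nonneg (by have := hk.1; positivity)]
  have h := two_mul_mul_exp_le (r := ‖p - q‖) hα
  have h0 : 0 ≤ 2 * α * ‖p - q‖ * Real.exp (-α * ‖p - q‖ ^ 2) := by positivity
  nlinarith [hk.1, hk.2]

/-- The strength at `q` of the best signal: a maximum over all robots, as a sup norm. -/
noncomputable def bestSignal (k α : ℝ) (P : Robots N d) (q : Pt d) : ℝ :=
  ‖fun i => k * Real.exp (-α * ‖P i - q‖ ^ 2)‖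

lemma continuous_bestSignal (P : Robots N d) : Continuous (bestSignal k α P) := by
  unfold bestSignal
  fun_prop

lemma abs_bestSignal_sub_le (hk : k ∈ Ioo (0 : ℝ) 1) (hα : 0 < α) (P P' : Robots N d)
    (q : Pt d) : |bestSignal k α P q - bestSignal k α P' q| ≤ (α + 1) * ‖P - P'‖ := by
  refine (abs_norm_sub_norm_le _ _).trans ((pi_norm_le_iff_of_nonneg (by positivity)).2 ?_)
  intro i
  refine (abs_gaussian_sub_le hk hα _ _ q).trans ?_
  gcongr
  exact norm_le_pi_norm (P - P') i

lemma bestSignal_eq (hk : 0 ≤ k) (hα : 0 ≤ α) {P : Robots N d} {q : Pt d} {i : Fin N}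
    (h : ∀ j, ‖q - P i‖ ≤ ‖q - P j‖) :
    bestSignal k α P q = k * Real.exp (-α * ‖P i - q‖ ^ 2) := by
  have hpos : ∀ j, 0 ≤ k * Real.exp (-α * ‖P j - q‖ ^ 2) := fun j => by positivity
  refine le_antisymm ((pi_norm_le_iff_of_nonneg (hpos i)).2 fun j => ?_) ?_
  · rw [Real.norm_of_nonneg (hpos j)]
    have := h j
    rw [norm_sub_rev q, norm_sub_rev q] at this
    have h2 : ‖P i - q‖ ^ 2 ≤ ‖P j - q‖ ^ 2 := by gcongr
    refine mul_le_mul_of_nonneg_left (Real.exp_le_exp.2 ?_) hk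
    nlinarith
  · have := norm_le_pi_norm (fun i => k * Real.exp (-α * ‖P i - q‖ ^ 2)) i
    rwa [Real.norm_of_nonneg (hpos i)] at this

lemma ae_pairwise_norm_sub_ne (s : Set (Pt d)) {P : Robots N d}
    (hP : ∀ i j, i ≠ j → P i ≠ P j) :
    ∀ᵐ q ∂(volume.restrict s), ∀ i j, i ≠ j → ‖q - P i‖ ≠ ‖q - P j‖ := by
  rw [ae_all_iff]
  intro i
  rw [ae_all_iff]
  intro j
  by_cases h : i = j
  · simp [h]
  · filter_upwards [ae_norm_sub_ne s (hP i j h)] with q hq _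
    exact hq

lemma sum_indicator_voronoiCell {E : Type*} [AddCommMonoid E] {P : Robots N d} {q : Pt d}
    (hq : q ∈ Q) {i : Fin N} (hi : ∀ j, j ≠ i → ‖q - P i‖ < ‖q - P j‖)
    (f : Fin N → Pt d → E) :
    ∑ j, (voronoiCell Q P j).indicator (f j) q = f i q := by
  rw [Finset.sum_eq_single i]
  · refine indicator_of_mem (show q ∈ voronoiCell Q P i from ⟨hq, fun j => ?_⟩) _
    by_cases h : j = i
    · simp [h]
    · exact (hi j h).le
  · intro j _ hj
    have : q ∉ voronoiCell Q P j := fun h => absurd (h.2 i) (not_le.2 (hi j hj))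
    exact indicator_of_notMem this _
  · simp

lemma exists_nearest [NeZero N] {P : Robots N d} {q : Pt d}
    (h : ∀ i j, i ≠ j → ‖q - P i‖ ≠ ‖q - P j‖) :
    ∃ i, ∀ j, j ≠ i → ‖q - P i‖ < ‖q - P j‖ := by
  obtain ⟨i, hi⟩ := Finite.exists_min fun i => ‖q - P i‖
  exact ⟨i, fun j hj => lt_of_le_of_ne (hi j) (h i j hj.symm)⟩

lemma searchObjective_eq_integral [NeZero N] (hQ : IsCompact Q)
    (hφm : AEMeasurable φ (volume.restrict Q)) (hφ : ∀ q ∈ Q, φ q ∈ Icc (0 : ℝ) 1)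
    (hk : 0 ≤ k) (hα : 0 ≤ α) {P : Robots N d} (hP : ∀ i j, i ≠ j → P i ≠ P j) :
    searchObjective Q φ k α P = ∫ q in Q, φ q * bestSignal k α P q := by
  have h1 : ∀ i, ∫ q in voronoiCell Q P i, φ q * (1 - searchBeta k α ‖P i - q‖)
      = ∫ q in Q, (voronoiCell Q P i).indicator
          (fun q => φ q • (k * Real.exp (-α * ‖P i - q‖ ^ 2))) q := by
    intro i
    rw [setIntegral_indicator (isClosed_voronoiCell hQ.isClosed _ _).measurableSet,
      inter_eq_self_of_subset_right (voronoiCell_subset Q P i)]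
    simp [searchBeta]
  simp only [searchObjective, h1]
  rw [← integral_finsetSum]
  · refine integral_congr_ae ?_
    filter_upwards [ae_pairwise_norm_sub_ne Q hP, ae_restrict_mem hQ.measurableSet]
      with q hq hqQ
    obtain ⟨i, hi⟩ := exists_nearest hq
    rw [sum_indicator_voronoiCell hqQ hi
      (fun i q => φ q • (k * Real.exp (-α * ‖P i - q‖ ^ 2))), smul_eq_mul, bestSignal_eq hk hα]
    intro j
    by_cases h : j = i
    · simp [h]
    · exact (hi j h).le
  · intro i _
    exact Integrable.indicator (integrableOn_density_smul hQ hφm hφ (by fun_prop))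
      (isClosed_voronoiCell hQ.isClosed _ _).measurableSet

/-- The linear form `h ↦ ⟪v, h i⟫`, as a function of `v`. -/
noncomputable def innerProj (i : Fin N) : Pt d →L[ℝ] (Robots N d →L[ℝ] ℝ) :=
  ((ContinuousLinearMap.compL ℝ (Robots N d) (Pt d) ℝ).flip (ContinuousLinearMap.proj i)).comp
    (innerSL ℝ)

@[simp]
lemma innerProj_apply (i : Fin N) (v : Pt d) (h : Robots N d) :
    innerProj i v h = inner ℝ v (h i) := rfl

/-- A strictly nearest robot remains nearest for nearby configurations, so the maximum is locally
the single Gaussian of that robot. -/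
lemma hasFDerivAt_bestSignal (hk : 0 ≤ k) (hα : 0 ≤ α) {P : Robots N d} {q : Pt d} {i : Fin N}
    (hi : ∀ j, j ≠ i → ‖q - P i‖ < ‖q - P j‖) :
    HasFDerivAt (fun P : Robots N d => bestSignal k α P q)
      (innerProj i ((2 * α * (k * Real.exp (-α * ‖P i - q‖ ^ 2))) • (q - P i))) P := by
  have hev : ∀ᶠ P' : Robots N d in 𝓝 P, ∀ j, ‖q - P' i‖ ≤ ‖q - P' j‖ := by
    rw [eventually_all]
    intro j
    by_cases h : j = i
    · simp [h]
    · have hc : ∀ j, ContinuousAt (fun P' : Robots N d => ‖q - P' j‖) P := fun j =>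
        (continuous_const.sub (continuous_apply j)).norm.continuousAt
      filter_upwards [(hc i).eventually_lt (hc j) (hi j h)] with P' h using h.le
  have hproj : HasFDerivAt (fun P : Robots N d => P i)
      (ContinuousLinearMap.proj i : Robots N d →L[ℝ] Pt d) P :=
    (ContinuousLinearMap.proj (R := ℝ) (φ := fun _ : Fin N => Pt d) i).hasFDerivAt
  have h := (hasFDerivAt_gaussian k α (P i) q).comp P hproj
  refine (h.congr_of_eventuallyEq ?_).congr_fderiv ?_
  · filter_upwards [hev] with P' hP'
    exact bestSignal_eq hk hα hP'
  · ext v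
    simp

lemma eventually_pairwise_ne {P : Robots N d} (hP : ∀ i j, i ≠ j → P i ≠ P j) :
    ∀ᶠ P' : Robots N d in 𝓝 P, ∀ i j, i ≠ j → P' i ≠ P' j := by
  rw [eventually_all]
  intro i
  rw [eventually_all]
  intro j
  by_cases h : i = j
  · simp [h]
  · have hc : ContinuousAt (fun P' : Robots N d => P' i - P' j) P :=
      ((continuous_apply i).sub (continuous_apply j)).continuousAt
    filter_upwards [hc.eventually_ne (sub_ne_zero.2 (hP i j h))] with P' hP' _
    exact sub_ne_zero.1 hP'

/-- Differentiation under the integral with Lipschitz bound `α + 1`. Points equidistant from two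
robots, where the maximum may fail to be differentiable, form a null set. -/
lemma hasFDerivAt_integral_bestSignal [NeZero N] (hQ : IsCompact Q)
    (hφm : AEMeasurable φ (volume.restrict Q)) (hφ : ∀ q ∈ Q, φ q ∈ Icc (0 : ℝ) 1)
    (hk : k ∈ Ioo (0 : ℝ) 1) (hα : 0 < α) {P : Robots N d} (hP : ∀ i j, i ≠ j → P i ≠ P j) :
    HasFDerivAt (fun P' : Robots N d => ∫ q in Q, φ q * bestSignal k α P' q)
      (∑ i, innerProj i ((2 * α) • perceivedMoment Q φ k α P i)) P := by
  let g : Fin N → Pt d → Pt d := fun i q =>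
    φ q • ((2 * α * (k * Real.exp (-α * ‖P i - q‖ ^ 2))) • (q - P i))
  have hgint : ∀ i, IntegrableOn (g i) Q := fun i =>
    integrableOn_density_smul hQ hφm hφ (by fun_prop)
  have hgi : ∀ i, Integrable ((voronoiCell Q P i).indicator fun q => innerProj i (g i q))
      (volume.restrict Q) := fun i =>
    Integrable.indicator ((innerProj i).integrable_comp (hgint i))
      (isClosed_voronoiCell hQ.isClosed _ _).measurableSet
  have hderiv : HasFDerivAt (fun P' : Robots N d => ∫ q in Q, φ q * bestSignal k α P' q)
      (∫ q in Q, ∑ i, (voronoiCell Q P i).indicator (fun q => innerProj i (g i q)) q) P := by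
    have hmeas : ∀ P' : Robots N d,
        AEStronglyMeasurable (fun q => φ q * bestSignal k α P' q) (volume.restrict Q) := fun P' =>
      hφm.aestronglyMeasurable.mul (continuous_bestSignal P').aestronglyMeasurable
    have hint : Integrable (fun q => φ q * bestSignal k α P q) (volume.restrict Q) :=
      integrableOn_density_smul hQ hφm hφ (continuous_bestSignal P)
    have hmeas' : AEStronglyMeasurable (fun q => ∑ i, (voronoiCell Q P i).indicator
        (fun q => innerProj i (g i q)) q) (volume.restrict Q) := by
      exact Finset.aestronglyMeasurable_fun_sum _ fun i _ => (hgi i).aestronglyMeasurable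
    refine (hasFDerivAt_integral_of_dominated_loc_of_lip (bound := fun _ => α + 1)
      univ_mem (Eventually.of_forall hmeas) hint hmeas' ?_ ?_ ?_).2
    · filter_upwards [ae_restrict_mem hQ.measurableSet] with q hq
      refine LipschitzOnWith.of_dist_le_mul fun P₁ _ P₂ _ => ?_
      rw [Real.dist_eq, ← mul_sub, abs_mul, abs_of_nonneg (hφ q hq).1, dist_eq_norm,
        Real.coe_nnabs, abs_of_pos (show 0 < α + 1 by positivity)]
      exact (mul_le_of_le_one_left (abs_nonneg _) (hφ q hq).2).trans
        (abs_bestSignal_sub_le hk hα _ _ q)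
    · exact integrableOn_const hQ.measure_lt_top.ne
    · filter_upwards [ae_pairwise_norm_sub_ne Q hP, ae_restrict_mem hQ.measurableSet]
        with q hq hqQ
      obtain ⟨i, hi⟩ := exists_nearest hq
      rw [sum_indicator_voronoiCell hqQ hi (fun i q => innerProj i (g i q))]
      have := (hasFDerivAt_bestSignal hk.1.le hα.le hi).const_mul (φ q)
      rwa [← map_smul] at this
  have heq : ∫ q in Q, ∑ i, (voronoiCell Q P i).indicator (fun q => innerProj i (g i q)) q
      = ∑ i, innerProj i ((2 * α) • perceivedMoment Q φ k α P i) := by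
    rw [integral_finsetSum _ fun i _ => hgi i]
    refine Finset.sum_congr rfl fun i _ => ?_
    rw [setIntegral_indicator (isClosed_voronoiCell hQ.isClosed _ _).measurableSet,
      inter_eq_self_of_subset_right (voronoiCell_subset Q P i),
      ContinuousLinearMap.integral_comp_comm _ ((hgint i).mono_set (voronoiCell_subset Q P i)),
      perceivedMoment_eq, ← integral_smul]
    congr 2
    ext1 q
    simp only [g]
    module
  rwa [heq] at hderiv

lemma hasFDerivAt_searchObjective (hQ : IsCompact Q)
    (hφm : AEMeasurable φ (volume.restrict Q)) (hφ : ∀ q ∈ Q, φ q ∈ Icc (0 : ℝ) 1)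
    (hk : k ∈ Ioo (0 : ℝ) 1) (hα : 0 < α) {P : Robots N d} (hP : ∀ i j, i ≠ j → P i ≠ P j) :
    HasFDerivAt (searchObjective Q φ k α)
      (∑ i, innerProj i ((2 * α) • perceivedMoment Q φ k α P i)) P := by
  rcases Nat.eq_zero_or_pos N with rfl | hN
  · exact hasFDerivAt_of_subsingleton _ _ |>.congr_fderiv (Subsingleton.elim _ _)
  have : NeZero N := ⟨hN.ne'⟩
  refine (hasFDerivAt_integral_bestSignal hQ hφm hφ hk hα hP).congr_of_eventuallyEq ?_
  filter_upwards [eventually_pairwise_ne hP] with P' hP'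
  exact searchObjective_eq_integral hQ hφm hφ hk.1.le hα.le hP'

lemma isCompact_of_isConvexPolytope (hQ : IsConvexPolytope Q) : IsCompact Q := by
  obtain ⟨s, rfl⟩ := hQ
  exact s.finite_toSet.isCompact_convexHull ℝ

lemma criticalConfigs_eq (hQ : IsCompact Q)
    (hφm : AEMeasurable φ (volume.restrict Q)) (hφ : ∀ q ∈ Q, φ q ∈ Icc (0 : ℝ) 1)
    (hk : k ∈ Ioo (0 : ℝ) 1) (hα : 0 < α)
    (hmass : ∀ P ∈ configSpace N Q, ∀ i, 0 < perceivedMass Q φ k α P i) :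
    criticalConfigs Q (searchObjective (N := N) Q φ k α) = centroidalConfigs N Q φ k α := by
  ext P
  refine and_congr_right fun hP => ?_
  have hD := hasFDerivAt_searchObjective hQ hφm hφ hk hα hP.2
  have hv : ∀ i, perceivedMoment Q φ k α P i = 0 ↔ P i = perceivedCentroid Q φ k α P i := by
    intro i
    rw [perceivedMoment_eq_smul hQ hφm hφ (hmass P hP i), smul_eq_zero, sub_eq_zero,
      or_iff_right (hmass P hP i).ne', eq_comm]
  simp only [← hv]
  constructor
  · intro h0 i
    -- Evaluating the derivative at the moment itself, placed in slot `i`, gives `2α` times its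
    -- squared norm.
    have h1 := congrArg (fun L : Robots N d →L[ℝ] ℝ =>
      L (Pi.single i (perceivedMoment Q φ k α P i))) (hD.unique h0)
    simp only [sum_apply, innerProj_apply, zero_apply]
      at h1
    rw [Finset.sum_eq_single i] at h1
    · simpa [inner_smul_left, hα.ne'] using h1
    · intro j _ hj
      simp [Pi.single_eq_of_ne hj]
    · simp
  · intro h
    simpa [h] using hD

end Objective

/-! ### Invariance of the configuration space -/

section Trajectories

variable {N d : ℕ} {Q : Set (Pt d)} {φ : Pt d → ℝ} {k α : ℝ} {U : Fin N → ℝ} {δ : ℝ}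

/-- The sign of the derivative is needed only where `f` exceeds `c`, so `f` is compared with a
barrier of slope `ε` lying strictly above `c`, and then `ε` tends to zero. -/
lemma image_le_of_deriv_nonpos_of_lt {f f' : ℝ → ℝ} {a b c : ℝ}
    (hf : ∀ x ∈ Icc a b, HasDerivWithinAt f (f' x) (Ici a) x) (ha : f a ≤ c)
    (hf' : ∀ x ∈ Ico a b, c < f x → f' x ≤ 0) : ∀ x ∈ Icc a b, f x ≤ c := by
  intro x hx
  have key : ∀ ε > 0, f x ≤ c + ε * (1 + (x - a)) := by
    intro ε hε
    refine image_le_of_deriv_right_lt_deriv_boundary' (f := f) (f' := f') (a := a) (b := b)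
      (B := fun s => c + ε * (1 + (s - a))) (B' := fun _ => ε)
      (fun s hs => (hf s hs).continuousWithinAt.mono Icc_subset_Ici_self)
      (fun s hs => (hf s (Ico_subset_Icc_self hs)).mono (Ici_subset_Ici.2 hs.1)) ?_
      (by fun_prop) (fun s _ => ?_) (fun s hs h => ?_) hx
    · simp only [sub_self, add_zero, mul_one]
      linarith
    · have := ((((hasDerivAt_id s).sub_const a).const_add 1).const_mul ε).const_add c
      simpa using this.hasDerivWithinAt
    · refine (hf' s hs ?_).trans_lt hε
      rw [h]
      have : 0 < ε * (1 + (s - a)) := mul_pos hε (by linarith [hs.1])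
      linarith
  have h1 : 0 < 1 + (x - a) := by linarith [hx.1]
  refine le_of_forall_pos_le_add fun ε hε => ?_
  have := key (ε / (1 + (x - a))) (div_pos hε h1)
  rwa [div_mul_cancel₀ _ h1.ne'] at this

/-- Both branches of the law are treated at once through a gain `g`: the lower bound drives the
objective, `g ≤ U i / δ` prevents collisions, and the third bound limits the speed. -/
lemma constSpeedControl_eq_smul (hδ : 0 < δ) (hU : ∀ i, 0 < U i) (P : Robots N d) (i : Fin N) :
    ∃ g : ℝ, U i / (δ + ‖P i - perceivedCentroid Q φ k α P i‖) ≤ g ∧ g ≤ U i / δ ∧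
      g * ‖perceivedCentroid Q φ k α P i - P i‖ ≤ U i ∧
      constSpeedControl Q φ k α U δ P i = g • (perceivedCentroid Q φ k α P i - P i) := by
  have hUi := (hU i).le
  have hn := norm_nonneg (P i - perceivedCentroid Q φ k α P i)
  unfold constSpeedControl
  split_ifs with h
  · have hpos := hδ.trans_le h
    refine ⟨U i / ‖P i - perceivedCentroid Q φ k α P i‖, ?_, ?_, ?_, ?_⟩
    · gcongr
      linarith
    · gcongr
    · rw [norm_sub_rev (perceivedCentroid Q φ k α P i), div_mul_cancel₀ _ hpos.ne']
    · rw [neg_smul, ← smul_neg, neg_sub]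
  · refine ⟨U i / δ, ?_, le_rfl, ?_, ?_⟩
    · gcongr
      linarith
    · rw [norm_sub_rev, div_mul_eq_mul_div, div_le_iff₀ hδ]
      exact mul_le_mul_of_nonneg_left (not_le.1 h).le hUi
    · rw [neg_smul, ← smul_neg, neg_sub]

lemma norm_constSpeedControl_le (hδ : 0 < δ) (hU : ∀ i, 0 < U i) (P : Robots N d) (i : Fin N) :
    ‖constSpeedControl Q φ k α U δ P i‖ ≤ U i := by
  obtain ⟨g, hg, -, hgU, h⟩ := constSpeedControl_eq_smul (Q := Q) (φ := φ) (k := k) (α := α)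
    hδ hU P i
  have hUi := (hU i).le
  rw [h, norm_smul, Real.norm_of_nonneg ((by positivity : (0 : ℝ) ≤ _).trans hg)]
  exact hgU

lemma perceivedCentroid_mem (hQ : IsCompact Q) (hQc : Convex ℝ Q)
    (hφm : AEMeasurable φ (volume.restrict Q))
    (hφ : ∀ q ∈ Q, φ q ∈ Icc (0 : ℝ) 1) (hk : 0 ≤ k) {P : Robots N d} {i : Fin N}
    (hm : 0 < perceivedMass Q φ k α P i) : perceivedCentroid Q φ k α P i ∈ Q := by
  by_contra h
  obtain ⟨f, u, hfu, hu⟩ := geometric_hahn_banach_closed_point hQc hQ.isClosed h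
  exact absurd (inner_perceivedCentroid_le hQ hφm hφ hk hm f fun q hq => (hfu q hq.1).le)
    (not_le.2 hu)

/-- The centroid is on the `i` side of the bisector, so going to it brings robot `i` at most halfway
toward robot `j`. -/
lemma neg_le_inner_perceivedCentroid_sub (hQ : IsCompact Q)
    (hφm : AEMeasurable φ (volume.restrict Q))
    (hφ : ∀ q ∈ Q, φ q ∈ Icc (0 : ℝ) 1) (hk : 0 ≤ k) {P : Robots N d} {i : Fin N}
    (hm : 0 < perceivedMass Q φ k α P i) (j : Fin N) :
    -(‖P i - P j‖ ^ 2 / 2) ≤ inner ℝ (P i - P j) (perceivedCentroid Q φ k α P i - P i) := by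
  have h := inner_perceivedCentroid_le hQ hφm hφ hk hm (-innerSL ℝ (P i - P j))
    (b := ‖P i - P j‖ ^ 2 / 2 - inner ℝ (P i - P j) (P i)) (fun q hq => ?_)
  · simp only [neg_apply, innerSL_apply_apply] at h
    rw [inner_sub_right]
    linarith
  · have h1 := (norm_sub_le_iff_inner q (P i) (P j)).1 (hq.2 j)
    have h2 : q - (2⁻¹ : ℝ) • (P i + P j) = (q - P i) + (2⁻¹ : ℝ) • (P i - P j) := by module
    rw [h2, inner_add_left, real_inner_smul_left, real_inner_self_eq_norm_sq, inner_sub_left]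
      at h1
    simp only [neg_apply, innerSL_apply_apply]
    rw [real_inner_comm q, real_inner_comm (P i) (P i - P j)]
    linarith

lemma neg_le_inner_sub_control (hQ : IsCompact Q) (hφm : AEMeasurable φ (volume.restrict Q))
    (hφ : ∀ q ∈ Q, φ q ∈ Icc (0 : ℝ) 1) (hk : 0 ≤ k) (hδ : 0 < δ) (hU : ∀ i, 0 < U i)
    {P : Robots N d} (hm : ∀ i, 0 < perceivedMass Q φ k α P i) (i j : Fin N) :
    -((U i + U j) / δ * ‖P i - P j‖ ^ 2) ≤ 2 * inner ℝ (P i - P j)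
      (constSpeedControl Q φ k α U δ P i - constSpeedControl Q φ k α U δ P j) := by
  obtain ⟨g, hg, hgU, -, h⟩ := constSpeedControl_eq_smul (Q := Q) (φ := φ) (k := k) (α := α)
    hδ hU P i
  obtain ⟨g', hg', hgU', -, h'⟩ := constSpeedControl_eq_smul (Q := Q) (φ := φ) (k := k) (α := α)
    hδ hU P j
  have hUi := (hU i).le
  have hUj := (hU j).le
  have h0 : 0 ≤ g := (by positivity : (0 : ℝ) ≤ _).trans hg
  have h0' : 0 ≤ g' := (by positivity : (0 : ℝ) ≤ _).trans hg'
  have h1 := neg_le_inner_perceivedCentroid_sub hQ hφm hφ hk (hm i) j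
  have h2 := neg_le_inner_perceivedCentroid_sub hQ hφm hφ hk (hm j) i
  rw [norm_sub_rev, ← neg_sub (P i) (P j), inner_neg_left] at h2
  rw [h, h', inner_sub_right, real_inner_smul_right, real_inner_smul_right, add_div]
  have h3 := mul_le_mul_of_nonneg_left h1 h0
  have h4 := mul_le_mul_of_nonneg_left h2 h0'
  have h5 := mul_le_mul_of_nonneg_right hgU (sq_nonneg ‖P i - P j‖)
  have h6 := mul_le_mul_of_nonneg_right hgU' (sq_nonneg ‖P i - P j‖)
  linarith

lemma IsTrajectory.hasDerivWithinAt {u : Robots N d → Fin N → Pt d} {P : ℝ → Robots N d}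
    (hP : IsTrajectory u P) {t : ℝ} (ht : 0 ≤ t) :
    HasDerivWithinAt P (u (P t)) (Ici 0) t :=
  hasDerivWithinAt_pi.2 fun i => hP t ht i

lemma IsTrajectory.continuousOn {u : Robots N d → Fin N → Pt d} {P : ℝ → Robots N d}
    (hP : IsTrajectory u P) : ContinuousOn P (Ici 0) :=
  fun _ ht => (hP.hasDerivWithinAt ht).continuousWithinAt

lemma IsTrajectory.mem_of_mem (hQ : IsCompact Q) (hQc : Convex ℝ Q)
    (hφm : AEMeasurable φ (volume.restrict Q))
    (hφ : ∀ q ∈ Q, φ q ∈ Icc (0 : ℝ) 1) (hk : 0 ≤ k) (hδ : 0 < δ) (hU : ∀ i, 0 < U i)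
    {P : ℝ → Robots N d} (hP : IsTrajectory (constSpeedControl Q φ k α U δ) P) {a b : ℝ}
    (ha : 0 ≤ a) (hab : a ≤ b)
    (hm : ∀ t ∈ Icc a b, ∀ i, 0 < perceivedMass Q φ k α (P t) i) {i : Fin N}
    (hi : P a i ∈ Q) : P b i ∈ Q := by
  by_contra h
  obtain ⟨f, u, hfu, hu⟩ := geometric_hahn_banach_closed_point hQc hQ.isClosed h
  refine absurd (image_le_of_deriv_nonpos_of_lt (f := fun t => f (P t i))
    (f' := fun t => f (constSpeedControl Q φ k α U δ (P t) i)) (a := a) (b := b) (c := u)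
    (fun t ht => ?_) (hfu _ hi).le (fun t ht hlt => ?_) b ⟨hab, le_rfl⟩) (not_le.2 hu)
  · exact (f.hasFDerivAt.comp_hasDerivWithinAt t (hP t (ha.trans ht.1) i)).mono
      (Ici_subset_Ici.2 ha)
  · obtain ⟨g, hg, -, -, hg'⟩ := constSpeedControl_eq_smul (Q := Q) (φ := φ) (k := k) (α := α)
      hδ hU (P t) i
    have hUi := (hU i).le
    have h0 : 0 ≤ g := (by positivity : (0 : ℝ) ≤ _).trans hg
    rw [hg', map_smul, map_sub, smul_eq_mul]
    refine mul_nonpos_of_nonneg_of_nonpos h0 ?_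
    have := inner_perceivedCentroid_le hQ hφm hφ hk (hm t (Ico_subset_Icc_self ht) i) f
      fun q hq => (hfu q hq.1).le
    linarith

/-- By `neg_le_inner_sub_control` the squared distance decays at rate at most `(U i + U j) / δ`;
multiplied by the matching exponential it is nondecreasing. -/
lemma IsTrajectory.sq_norm_sub_mul_exp_le (hQ : IsCompact Q)
    (hφm : AEMeasurable φ (volume.restrict Q))
    (hφ : ∀ q ∈ Q, φ q ∈ Icc (0 : ℝ) 1) (hk : 0 ≤ k) (hδ : 0 < δ) (hU : ∀ i, 0 < U i)
    {P : ℝ → Robots N d} (hP : IsTrajectory (constSpeedControl Q φ k α U δ) P) {a b : ℝ}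
    (ha : 0 ≤ a) (hab : a ≤ b)
    (hm : ∀ t ∈ Icc a b, ∀ i, 0 < perceivedMass Q φ k α (P t) i) (i j : Fin N) :
    ‖P a i - P a j‖ ^ 2 * Real.exp ((U i + U j) / δ * a)
      ≤ ‖P b i - P b j‖ ^ 2 * Real.exp ((U i + U j) / δ * b) := by
  set c := (U i + U j) / δ with hc
  have h := image_le_of_deriv_nonpos_of_lt
    (f := fun t => -(‖P t i - P t j‖ ^ 2 * Real.exp (c * t)))
    (f' := fun t => -(2 * inner ℝ (P t i - P t j) (constSpeedControl Q φ k α U δ (P t) i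
        - constSpeedControl Q φ k α U δ (P t) j) * Real.exp (c * t)
      + ‖P t i - P t j‖ ^ 2 * (Real.exp (c * t) * c)))
    (a := a) (b := b) (c := -(‖P a i - P a j‖ ^ 2 * Real.exp (c * a)))
    (fun t ht => ?_) le_rfl (fun t ht _ => ?_) b ⟨hab, le_rfl⟩
  · linarith
  · have h0 := ha.trans ht.1
    have h1 := ((hP t h0 i).sub (hP t h0 j)).norm_sq
    have h2 : HasDerivAt (fun t => Real.exp (c * t)) (Real.exp (c * t) * c) t := by
      simpa using ((hasDerivAt_id t).const_mul c).exp
    exact ((h1.mul h2.hasDerivWithinAt).neg).mono (Ici_subset_Ici.2 ha)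
  · have h1 := neg_le_inner_sub_control hQ hφm hφ hk hδ hU (hm t (Ico_subset_Icc_self ht)) i j
    rw [← hc] at h1
    have h2 := mul_le_mul_of_nonneg_right h1 (Real.exp_pos (c * t)).le
    linarith

/-- Continuous induction on time. The estimates need positive masses, which are assumed only on
configurations in `Q`; the quantitative distance bound makes the set of good times closed. -/
lemma IsTrajectory.mem_configSpace (hQ : IsCompact Q) (hQc : Convex ℝ Q)
    (hφm : AEMeasurable φ (volume.restrict Q))
    (hφ : ∀ q ∈ Q, φ q ∈ Icc (0 : ℝ) 1) (hk : 0 ≤ k) (hδ : 0 < δ) (hU : ∀ i, 0 < U i)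
    (hmass : ∀ P ∈ configSpace N Q, ∀ i, 0 < perceivedMass Q φ k α P i)
    {P : ℝ → Robots N d} (hP : IsTrajectory (constSpeedControl Q φ k α U δ) P)
    (hP0 : P 0 ∈ configSpace N Q) {t : ℝ} (ht : 0 ≤ t) : P t ∈ configSpace N Q := by
  -- Nothing is known about negative times, so the trajectory is frozen there by `max s 0`.
  have hcont : Continuous fun s : ℝ => P (max s 0) :=
    hP.continuousOn.comp_continuous (by fun_prop) fun s => le_max_right s 0
  have hconti : ∀ i, Continuous fun s : ℝ => P (max s 0) i := fun i =>
    (continuous_apply i).comp hcont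
  let S : Set ℝ := {s | (∀ i, P (max s 0) i ∈ Q) ∧ ∀ i j, i ≠ j →
    ‖P 0 i - P 0 j‖ ^ 2
      ≤ ‖P (max s 0) i - P (max s 0) j‖ ^ 2 * Real.exp ((U i + U j) / δ * max s 0)}
  have hS : IsClosed S := by
    simp only [S, ofPred_and, ofPred_forall]
    refine (isClosed_iInter fun i => hQ.isClosed.preimage (hconti i)).inter
      (isClosed_iInter fun i => isClosed_iInter fun j => isClosed_iInter fun _ => ?_)
    have hexp : Continuous fun s : ℝ => Real.exp ((U i + U j) / δ * max s 0) := by fun_prop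
    exact isClosed_le continuous_const ((((hconti i).sub (hconti j)).norm.pow 2).mul hexp)
  have hconf : ∀ s ∈ S, P (max s 0) ∈ configSpace N Q := by
    refine fun s hs => ⟨hs.1, fun i j hij h => ?_⟩
    have h1 := hs.2 i j hij
    rw [h, sub_self, norm_zero, zero_pow two_ne_zero, zero_mul] at h1
    have h2 : 0 < ‖P 0 i - P 0 j‖ := norm_pos_iff.2 (sub_ne_zero.2 (hP0.2 i j hij))
    have h3 : 0 < ‖P 0 i - P 0 j‖ ^ 2 := by positivity
    linarith
  suffices h : Icc 0 t ⊆ S by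
    simpa [ht] using hconf t (h ⟨ht, le_rfl⟩)
  refine (hS.inter isClosed_Icc).Icc_subset_of_forall_mem_nhdsWithin ?_ ?_
  · refine ⟨by simpa using hP0.1, by simp⟩
  · rintro a ⟨haS, ha0, -⟩
    have hmax : ∀ {s}, a ≤ s → max s 0 = s := fun h => max_eq_left (ha0.trans h)
    have hPa := hconf a haS
    have hev : ∀ᶠ s in 𝓝 a, ∀ i, 0 < perceivedMass Q φ k α (P (max s 0)) i := by
      rw [eventually_all]
      intro i
      exact ((continuousAt_perceivedMass hQ hφm hφ hPa.2 i).comp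
        (f := fun s : ℝ => P (max s 0)) hcont.continuousAt).eventually_const_lt
        (hmass _ hPa i)
    obtain ⟨r, har, hr⟩ := mem_nhdsGE_iff_exists_Ico_subset.1 (mem_nhdsWithin_of_mem_nhds hev)
    refine mem_nhdsGT_iff_exists_Ioo_subset.2 ⟨r, har, fun b hb => ?_⟩
    have hm : ∀ s ∈ Icc a b, ∀ i, 0 < perceivedMass Q φ k α (P s) i := by
      intro s hs
      have := hr ⟨hs.1, hs.2.trans_lt hb.2⟩
      simpa only [mem_ofPred_eq, hmax hs.1] using this
    obtain ⟨h1, h2⟩ := haS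
    simp only [hmax le_rfl] at h1 h2
    refine ⟨fun i => ?_, fun i j hij => ?_⟩
    · rw [hmax hb.1.le]
      exact hP.mem_of_mem hQ hQc hφm hφ hk hδ hU ha0 hb.1.le hm (h1 i)
    · rw [hmax hb.1.le]
      exact (h2 i j hij).trans
        (hP.sq_norm_sub_mul_exp_le hQ hφm hφ hk hδ hU ha0 hb.1.le hm i j)

end Trajectories

/-! ### Limits of configurations with vanishing moments -/

section Compactness

variable {N d : ℕ} {Q : Set (Pt d)} {φ : Pt d → ℝ} {k α : ℝ}

/-- When `P i = P j` the hyperplane with normal `e i j` passes through `P i`, so the moment paired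
with `e i j` has a nonnegative integrand. Its integral is zero, and off that null hyperplane this
forces `φ = 0`. -/
lemma ae_eq_zero_of_collision (hQ : IsCompact Q) (hφm : AEMeasurable φ (volume.restrict Q))
    (hφ : ∀ q ∈ Q, φ q ∈ Icc (0 : ℝ) 1) (hk : 0 < k) {P : Robots N d}
    {e : Fin N → Fin N → Pt d} {i j : Fin N} (hij : j ≠ i) (he : e i j ≠ 0) (hP : P i = P j)
    (hw : ∫ q in halfspaceCell Q P e i,
      φ q • ((k * Real.exp (-α * ‖P i - q‖ ^ 2)) • (q - P i)) = 0) :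
    ∀ᵐ q, q ∈ halfspaceCell Q P e i → φ q = 0 := by
  have hcell := (isClosed_halfspaceCell hQ.isClosed P e i).measurableSet
  have hsub : halfspaceCell Q P e i ⊆ Q := fun q hq => hq.1
  have hinner : ∀ q ∈ halfspaceCell Q P e i, 0 ≤ inner ℝ (e i j) (q - P i) := by
    intro q hq
    have := hq.2 j hij
    rwa [← hP, ← two_smul ℝ, inv_smul_smul₀ two_ne_zero, real_inner_comm] at this
  have h0 : ∫ q in halfspaceCell Q P e i,
      φ q * (k * Real.exp (-α * ‖P i - q‖ ^ 2) * inner ℝ (e i j) (q - P i)) = 0 := by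
    have h := ContinuousLinearMap.integral_comp_comm (innerSL ℝ (e i j))
      ((integrableOn_density_smul hQ hφm hφ
        (G := fun q => (k * Real.exp (-α * ‖P i - q‖ ^ 2)) • (q - P i))
        (by fun_prop)).mono_set hsub)
    rw [hw, map_zero] at h
    simpa only [map_smul, innerSL_apply_apply, smul_eq_mul] using h
  have hint : IntegrableOn (fun q => φ q * (k * Real.exp (-α * ‖P i - q‖ ^ 2) *
      inner ℝ (e i j) (q - P i))) (halfspaceCell Q P e i) :=
    (integrableOn_density_smul hQ hφm hφ (G := fun q => k * Real.exp (-α * ‖P i - q‖ ^ 2) *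
      inner ℝ (e i j) (q - P i)) (by fun_prop)).mono_set hsub
  rw [setIntegral_eq_zero_iff_of_nonneg_ae ?_ hint] at h0
  · rw [← ae_restrict_iff' hcell]
    filter_upwards [h0, ae_inner_ne_zero (halfspaceCell Q P e i) (P i) he] with q hq hne
    rw [real_inner_comm] at hne
    have hexp := Real.exp_pos (-α * ‖P i - q‖ ^ 2)
    simpa [hk.ne', hexp.ne', hne] using hq
  · filter_upwards [ae_restrict_mem hcell] with q hq
    have h1 := hinner q hq
    have h2 := (hφ q hq.1).1
    simp only [Pi.zero_apply]
    positivity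

/-- A nontrivial convex set is infinite, so the positions left after merging can be completed to `N`
distinct points. -/
lemma exists_configSpace_range_superset (hQc : Convex ℝ Q) (hQ : Q.Nontrivial)
    (P : Robots N d) (hP : ∀ i, P i ∈ Q) :
    ∃ P' ∈ configSpace N Q, ∀ i, ∃ j, P' j = P i := by
  classical
  have : Infinite Q := (hQc.isPreconnected.infinite_of_nontrivial hQ).to_subtype
  let p : Fin N → Q := fun i => ⟨P i, hP i⟩
  obtain ⟨T, hpT, hT⟩ := Infinite.exists_superset_card_eq (Finset.univ.image p) N
    (Finset.card_image_le.trans (by simp))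
  let E := (Finset.equivFinOfCardEq hT).symm
  refine ⟨fun j => (E j).1.1, ⟨fun j => (E j).1.2, fun i j hij h => hij ?_⟩, fun i => ?_⟩
  · exact E.injective (Subtype.ext (Subtype.ext h))
  · have hi : p i ∈ T := hpT (Finset.mem_image_of_mem p (Finset.mem_univ i))
    exact ⟨E.symm ⟨p i, hi⟩, by simp [p]⟩

/-- Limit cells still cover `Q`: among finitely many robots some cell contains `q` infinitely often,
and its closed conditions pass to the limit. -/
lemma exists_nearest_limit {x : ℕ → Robots N d} {e : ℕ → Fin N → Fin N → Pt d}
    {P : Robots N d} {E : Fin N → Fin N → Pt d} [Nonempty (Fin N)]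
    (hx : Tendsto x atTop (𝓝 P)) (he : Tendsto e atTop (𝓝 E))
    (hc : ∀ n i, voronoiCell Q (x n) i = halfspaceCell Q (x n) (e n) i) {q : Pt d} (hq : q ∈ Q) :
    ∃ i, q ∈ halfspaceCell Q P E i ∧ ∀ j, ‖q - P i‖ ≤ ‖q - P j‖ := by
  have hex : ∃ i, ∃ᶠ n in atTop, q ∈ voronoiCell Q (x n) i := by
    by_contra! hcon
    have hall : ∀ᶠ n in atTop, ∀ i, q ∉ voronoiCell Q (x n) i :=
      eventually_all.2 fun i => hcon i
    obtain ⟨n, hn⟩ := hall.exists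
    obtain ⟨i, hi⟩ := Finite.exists_min fun i => ‖q - x n i‖
    exact hn i ⟨hq, hi⟩
  obtain ⟨i, hi⟩ := hex
  let S : Set (Robots N d × (Fin N → Fin N → Pt d)) :=
    {y | (∀ j, j ≠ i → 0 ≤ inner ℝ (q - (2⁻¹ : ℝ) • (y.1 i + y.1 j)) (y.2 i j)) ∧
      ∀ j, ‖q - y.1 i‖ ≤ ‖q - y.1 j‖}
  have hS : IsClosed S := by
    simp only [S, ofPred_and, ofPred_forall]
    refine (isClosed_iInter fun j => isClosed_iInter fun _ => ?_).inter
      (isClosed_iInter fun j => ?_)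
    · exact isClosed_le (by fun_prop) (by fun_prop)
    · exact isClosed_le (by fun_prop) (by fun_prop)
  have hmem : (P, E) ∈ S := by
    refine hS.mem_of_frequently_of_tendsto (hi.mono fun n hn => ?_) (hx.prodMk_nhds he)
    exact ⟨((hc n i) ▸ hn : q ∈ halfspaceCell Q (x n) (e n) i).2, hn.2⟩
  exact ⟨i, ⟨hq, hmem.1⟩, hmem.2⟩

/-- Suppose robots merge at a point, and complete the limit positions to a genuine configuration
`P'`. The cell of that point in `P'` is covered, up to a null set, by the limit cells of the merged
robots, where `φ` vanishes; its mass is then zero, a contradiction. -/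
lemma pairwise_ne_of_limit (hQ : IsCompact Q) (hQc : Convex ℝ Q)
    (hφm : AEMeasurable φ (volume.restrict Q))
    (hφ : ∀ q ∈ Q, φ q ∈ Icc (0 : ℝ) 1) (hk : 0 < k)
    (hmass : ∀ P ∈ configSpace N Q, ∀ i, 0 < perceivedMass Q φ k α P i)
    {x : ℕ → Robots N d} (hxc : ∀ n, x n ∈ configSpace N Q)
    {e : ℕ → Fin N → Fin N → Pt d} {P : Robots N d} {E : Fin N → Fin N → Pt d}
    (hP : ∀ i, P i ∈ Q) (hx : Tendsto x atTop (𝓝 P)) (he : Tendsto e atTop (𝓝 E))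
    (hE : ∀ i j, j ≠ i → E i j ≠ 0)
    (hc : ∀ n i, voronoiCell Q (x n) i = halfspaceCell Q (x n) (e n) i)
    (hw : ∀ i, ∫ q in halfspaceCell Q P E i,
      φ q • ((k * Real.exp (-α * ‖P i - q‖ ^ 2)) • (q - P i)) = 0) :
    ∀ i j, i ≠ j → P i ≠ P j := by
  intro a b hab hPab
  have : Nonempty (Fin N) := ⟨a⟩
  have hnt : Q.Nontrivial := ⟨x 0 a, (hxc 0).1 a, x 0 b, (hxc 0).1 b, (hxc 0).2 a b hab⟩
  obtain ⟨P', hP', hrange⟩ := exists_configSpace_range_superset hQc hnt P hP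
  obtain ⟨m, hm⟩ := hrange a
  refine (hmass P' hP' m).ne' ?_
  have hcoll : ∀ i, P i = P a → ∀ᵐ q, q ∈ halfspaceCell Q P E i → φ q = 0 := by
    intro i hi
    -- Every robot at the collision point has a partner there: `b` for `a` itself, and `a` for any
    -- other.
    obtain ⟨j, hj, hji⟩ : ∃ j, P i = P j ∧ j ≠ i := by
      by_cases h : i = a
      · exact ⟨b, hi.trans hPab, fun hbi => hab (h.symm.trans hbi.symm)⟩
      · exact ⟨a, hi, fun h' => h h'.symm⟩
    exact ae_eq_zero_of_collision hQ hφm hφ hk hji (hE i j hji) hj (hw i)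
  have hcoll' : ∀ᵐ q, ∀ i, P i = P a → q ∈ halfspaceCell Q P E i → φ q = 0 := by
    rw [ae_all_iff]
    intro i
    by_cases hi : P i = P a
    · filter_upwards [hcoll i hi] with q hq _ using hq
    · simp [hi]
  rw [perceivedMass]
  refine integral_eq_zero_of_ae ?_
  filter_upwards [ae_restrict_of_ae hcoll', ae_pairwise_norm_sub_ne _ hP'.2,
    ae_restrict_mem (isClosed_voronoiCell hQ.isClosed P' m).measurableSet] with q hq hne hqm
  obtain ⟨i, hi, hmin⟩ := exists_nearest_limit hx he hc hqm.1
  obtain ⟨l, hl⟩ := hrange i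
  -- Otherwise `q` would be equidistant from two distinct points of `P'`, which is excluded almost
  -- everywhere.
  have hlm : l = m := by
    by_contra hlm
    refine hne l m hlm (le_antisymm ?_ (hqm.2 l))
    rw [hl, hm]
    exact hmin a
  have hia : P i = P a := by rw [← hl, ← hm, hlm]
  simp [perceivedDensity, hq i hia hi]

lemma exists_tendsto_centroidalConfigs (hQ : IsCompact Q) (hQc : Convex ℝ Q)
    (hφm : AEMeasurable φ (volume.restrict Q))
    (hφ : ∀ q ∈ Q, φ q ∈ Icc (0 : ℝ) 1) (hk : 0 < k)
    (hmass : ∀ P ∈ configSpace N Q, ∀ i, 0 < perceivedMass Q φ k α P i)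
    {x : ℕ → Robots N d} (hxc : ∀ n, x n ∈ configSpace N Q)
    (hv : ∀ i, Tendsto (fun n => perceivedMoment Q φ k α (x n) i) atTop (𝓝 0)) :
    ∃ P ∈ centroidalConfigs N Q φ k α, ∃ σ : ℕ → ℕ, StrictMono σ ∧
      Tendsto (x ∘ σ) atTop (𝓝 P) := by
  let e : ℕ → Fin N → Fin N → Pt d := fun n i j => ‖x n i - x n j‖⁻¹ • (x n i - x n j)
  have hpos : ∀ n i j, j ≠ i → 0 < ‖x n i - x n j‖ := fun n i j hji =>
    norm_pos_iff.2 (sub_ne_zero.2 ((hxc n).2 i j hji.symm))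
  have henorm : ∀ n i j, j ≠ i → ‖e n i j‖ = 1 := fun n i j hji => by
    simp [e, norm_smul, (hpos n i j hji).ne']
  have hele : ∀ n i j, e n i j ∈ Metric.closedBall (0 : Pt d) 1 := by
    intro n i j
    by_cases hji : j = i
    · simp [e, hji]
    · simp [henorm n i j hji]
  have hesmul : ∀ n i j, x n i - x n j = ‖x n i - x n j‖ • e n i j := by
    intro n i j
    by_cases hji : j = i
    · simp [hji]
    · simp [e, smul_smul, (hpos n i j hji).ne']
  have hcells : ∀ n i, voronoiCell Q (x n) i = halfspaceCell Q (x n) (e n) i := fun n i =>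
    voronoiCell_eq_halfspaceCell Q (x n) (e n) i fun j hji =>
      ⟨_, hpos n i j hji, hesmul n i j⟩
  have hK : IsCompact ((univ.pi fun _ : Fin N => Q) ×ˢ
      (univ.pi fun _ : Fin N => univ.pi fun _ : Fin N => Metric.closedBall (0 : Pt d) 1)) :=
    (isCompact_univ_pi fun _ => hQ).prod
      (isCompact_univ_pi fun _ => isCompact_univ_pi fun _ => isCompact_closedBall _ _)
  obtain ⟨⟨P, E⟩, ⟨hPQ, -⟩, σ, hσ, hlim⟩ := hK.tendsto_subseq (x := fun n => (x n, e n))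
    fun n => ⟨fun i _ => (hxc n).1 i, fun i _ j _ => hele n i j⟩
  have hPQ : ∀ i, P i ∈ Q := fun i => hPQ i (mem_univ i)
  have hxlim : Tendsto (x ∘ σ) atTop (𝓝 P) := (continuous_fst.tendsto _).comp hlim
  have helim : Tendsto (e ∘ σ) atTop (𝓝 E) := (continuous_snd.tendsto _).comp hlim
  have hxi : ∀ i, Tendsto (fun n => x (σ n) i) atTop (𝓝 (P i)) := fun i =>
    ((continuous_apply i).tendsto _).comp hxlim
  have hei : ∀ i j, Tendsto (fun n => e (σ n) i j) atTop (𝓝 (E i j)) := fun i j =>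
    ((continuous_apply_apply i j).tendsto E).comp helim
  have hE1 : ∀ i j, j ≠ i → E i j ≠ 0 := by
    intro i j hji h0
    have h1 : Tendsto (fun _ : ℕ => (1 : ℝ)) atTop (𝓝 ‖E i j‖) := by
      refine (hei i j).norm.congr fun n => henorm (σ n) i j hji
    have h2 := tendsto_nhds_unique h1 tendsto_const_nhds
    simp [h0] at h2
  have hEsmul : ∀ i j, P i - P j = ‖P i - P j‖ • E i j := by
    intro i j
    have h1 : Tendsto (fun n => x (σ n) i - x (σ n) j) atTop (𝓝 (‖P i - P j‖ • E i j)) := by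
      refine Tendsto.congr (fun n => (hesmul (σ n) i j).symm) ?_
      exact ((hxi i).sub (hxi j)).norm.smul (hei i j)
    exact tendsto_nhds_unique ((hxi i).sub (hxi j)) h1
  have hw : ∀ i, ∫ q in halfspaceCell Q P E i,
      φ q • ((k * Real.exp (-α * ‖P i - q‖ ^ 2)) • (q - P i)) = 0 := by
    intro i
    have hcont := continuousAt_integral_halfspaceCell hQ hφm hφ
      (G := fun y : Pt d × Pt d => (k * Real.exp (-α * ‖y.1 - y.2‖ ^ 2)) • (y.2 - y.1))
      (by fun_prop) P E i (hE1 i)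
    refine tendsto_nhds_unique (hcont.tendsto.comp hlim) ?_
    refine ((hv i).comp hσ.tendsto_atTop).congr fun n => ?_
    simp only [Function.comp_apply]
    rw [perceivedMoment_eq, hcells]
  have hPc : P ∈ configSpace N Q := ⟨hPQ, pairwise_ne_of_limit hQ hQc hφm hφ hk hmass
    (fun n => hxc (σ n)) hPQ hxlim helim hE1 (fun n i => hcells (σ n) i) hw⟩
  refine ⟨P, ⟨hPc, fun i => ?_⟩, σ, hσ, hxlim⟩
  have hcell : voronoiCell Q P i = halfspaceCell Q P E i :=
    voronoiCell_eq_halfspaceCell Q P E i fun j hji =>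
      ⟨_, norm_pos_iff.2 (sub_ne_zero.2 (hPc.2 i j hji.symm)), hEsmul i j⟩
  have hmom := hw i
  rw [← hcell, ← perceivedMoment_eq, perceivedMoment_eq_smul hQ hφm hφ (hmass P hPc i),
    smul_eq_zero, or_iff_right (hmass P hPc i).ne', sub_eq_zero] at hmom
  exact hmom.symm

end Compactness

/-! ### Growth of the objective and convergence of trajectories -/

section Convergence

variable {N d : ℕ} {Q : Set (Pt d)} {φ : Pt d → ℝ} {k α : ℝ} {U : Fin N → ℝ} {δ : ℝ}

lemma searchObjective_eq_sum_perceivedMass (Q : Set (Pt d)) (φ : Pt d → ℝ) (k α : ℝ)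
    (P : Robots N d) : searchObjective Q φ k α P = ∑ i, perceivedMass Q φ k α P i := by
  simp [searchObjective, perceivedMass, perceivedDensity, searchBeta]

/-- A lower bound for the rate of increase of the objective function along trajectories. -/
noncomputable def gainRate (Q : Set (Pt d)) (φ : Pt d → ℝ) (k α : ℝ) (U : Fin N → ℝ) (δ : ℝ)
    (P : Robots N d) : ℝ :=
  2 * α * ∑ i, U i / ((δ + Metric.diam Q) * (volume.real Q + 1)) *
    ‖perceivedMoment Q φ k α P i‖ ^ 2

lemma gainRate_nonneg (hα : 0 < α) (hU : ∀ i, 0 < U i) (hδ : 0 < δ) (P : Robots N d) :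
    0 ≤ gainRate Q φ k α U δ P := by
  refine mul_nonneg (by positivity) (Finset.sum_nonneg fun i _ => ?_)
  have := (hU i).le
  have := Metric.diam_nonneg (s := Q)
  positivity

/-- The inner product is `g M ‖C - p‖²`, while the squared moment is `M² ‖C - p‖²`. The constant
comes from `g ≥ U i / (δ + diam Q)` and `M ≤ vol Q`; the added `1` keeps the denominator positive.
-/
lemma mul_sq_norm_perceivedMoment_le (hQ : IsCompact Q) (hQc : Convex ℝ Q)
    (hφm : AEMeasurable φ (volume.restrict Q))
    (hφ : ∀ q ∈ Q, φ q ∈ Icc (0 : ℝ) 1) (hk : k ∈ Ioo (0 : ℝ) 1) (hα : 0 < α)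
    (hδ : 0 < δ) (hU : ∀ i, 0 < U i) {P : Robots N d} {i : Fin N} (hi : P i ∈ Q)
    (hm : 0 < perceivedMass Q φ k α P i) :
    U i / ((δ + Metric.diam Q) * (volume.real Q + 1)) * ‖perceivedMoment Q φ k α P i‖ ^ 2
      ≤ inner ℝ (perceivedMoment Q φ k α P i) (constSpeedControl Q φ k α U δ P i) := by
  obtain ⟨g, hg, -, -, hu⟩ := constSpeedControl_eq_smul (Q := Q) (φ := φ) (k := k) (α := α)
    hδ hU P i
  have hUi := hU i
  have hD := Metric.diam_nonneg (s := Q)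
  have hV : 0 ≤ volume.real Q := measureReal_nonneg
  have hdist : ‖P i - perceivedCentroid Q φ k α P i‖ ≤ Metric.diam Q := by
    rw [← dist_eq_norm]
    exact Metric.dist_le_diam_of_mem hQ.isBounded hi
      (perceivedCentroid_mem hQ hQc hφm hφ hk.1.le hm)
  have hg' : U i / (δ + Metric.diam Q) ≤ g := by
    refine le_trans ?_ hg
    gcongr
  have hM := perceivedMass_le hQ hφm hφ hk hα P i
  set M := perceivedMass Q φ k α P i with hMdef
  have hgM : U i / ((δ + Metric.diam Q) * (volume.real Q + 1)) * M ≤ g := by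
    refine le_trans ?_ hg'
    rw [← div_div, div_mul_eq_mul_div, div_le_iff₀ (by positivity)]
    refine mul_le_mul_of_nonneg_left (by linarith) (by positivity)
  rw [perceivedMoment_eq_smul hQ hφm hφ hm, hu, real_inner_smul_left, real_inner_smul_right,
    real_inner_self_eq_norm_sq, norm_smul, Real.norm_of_nonneg hm.le, ← hMdef]
  have h := mul_le_mul_of_nonneg_right hgM
    (mul_nonneg hm.le (sq_nonneg ‖perceivedCentroid Q φ k α P i - P i‖))
  linarith

lemma IsTrajectory.exists_hasDerivWithinAt_searchObjective (hQ : IsCompact Q)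
    (hQc : Convex ℝ Q) (hφm : AEMeasurable φ (volume.restrict Q))
    (hφ : ∀ q ∈ Q, φ q ∈ Icc (0 : ℝ) 1) (hk : k ∈ Ioo (0 : ℝ) 1) (hα : 0 < α)
    (hδ : 0 < δ) (hU : ∀ i, 0 < U i)
    (hmass : ∀ P ∈ configSpace N Q, ∀ i, 0 < perceivedMass Q φ k α P i)
    {P : ℝ → Robots N d} (hP : IsTrajectory (constSpeedControl Q φ k α U δ) P)
    (hP0 : P 0 ∈ configSpace N Q) {t : ℝ} (ht : 0 ≤ t) :
    ∃ D, gainRate Q φ k α U δ (P t) ≤ D ∧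
      HasDerivWithinAt (fun t => searchObjective Q φ k α (P t)) D (Ici 0) t := by
  have hPt := hP.mem_configSpace hQ hQc hφm hφ hk.1.le hδ hU hmass hP0 ht
  refine ⟨_, ?_, (hasFDerivAt_searchObjective hQ hφm hφ hk hα hPt.2).comp_hasDerivWithinAt t
    (hP.hasDerivWithinAt ht)⟩
  rw [sum_apply, gainRate, Finset.mul_sum]
  refine Finset.sum_le_sum fun i _ => ?_
  rw [innerProj_apply, real_inner_smul_left]
  exact mul_le_mul_of_nonneg_left (mul_sq_norm_perceivedMoment_le hQ hQc hφm hφ hk hα hδ hU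
    (hPt.1 i) (hmass _ hPt i)) (by positivity)

lemma IsTrajectory.mul_le_searchObjective_sub (hQ : IsCompact Q)
    (hQc : Convex ℝ Q) (hφm : AEMeasurable φ (volume.restrict Q))
    (hφ : ∀ q ∈ Q, φ q ∈ Icc (0 : ℝ) 1) (hk : k ∈ Ioo (0 : ℝ) 1) (hα : 0 < α)
    (hδ : 0 < δ) (hU : ∀ i, 0 < U i)
    (hmass : ∀ P ∈ configSpace N Q, ∀ i, 0 < perceivedMass Q φ k α P i)
    {P : ℝ → Robots N d} (hP : IsTrajectory (constSpeedControl Q φ k α U δ) P)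
    (hP0 : P 0 ∈ configSpace N Q) {a b η : ℝ} (ha : 0 ≤ a) (hab : a ≤ b)
    (hη : ∀ t ∈ Icc a b, η ≤ gainRate Q φ k α U δ (P t)) :
    η * (b - a) ≤ searchObjective Q φ k α (P b) - searchObjective Q φ k α (P a) := by
  choose! D hD hderiv using fun t (ht : 0 ≤ t) =>
    hP.exists_hasDerivWithinAt_searchObjective hQ hQc hφm hφ hk hα hδ hU hmass hP0 ht
  have h := image_le_of_deriv_nonpos_of_lt
    (f := fun t => η * (t - a) - searchObjective Q φ k α (P t)) (f' := fun t => η - D t)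
    (a := a) (b := b) (c := -searchObjective Q φ k α (P a))
    (fun t ht => ?_) (by simp) (fun t ht _ => ?_) b ⟨hab, le_rfl⟩
  · linarith
  · have h1 : HasDerivAt (fun t => η * (t - a)) η t := by
      simpa using ((hasDerivAt_id t).sub_const a).const_mul η
    exact (h1.hasDerivWithinAt.sub (hderiv t (ha.trans ht.1))).mono (Ici_subset_Ici.2 ha)
  · have h1 := hη t (Ico_subset_Icc_self ht)
    have h2 := hD t (ha.trans ht.1)
    linarith

lemma IsTrajectory.dist_le {P : ℝ → Robots N d} (hδ : 0 < δ) (hU : ∀ i, 0 < U i)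
    (hP : IsTrajectory (constSpeedControl Q φ k α U δ) P) {s t : ℝ} (hs : 0 ≤ s) (ht : 0 ≤ t) :
    dist (P s) (P t) ≤ (∑ i, U i) * |s - t| := by
  have h0 : 0 ≤ ∑ i, U i := Finset.sum_nonneg fun i _ => (hU i).le
  rw [dist_eq_norm, ← Real.norm_eq_abs]
  refine (convex_Ici (0 : ℝ)).norm_image_sub_le_of_norm_hasDerivWithin_le
    (fun t ht => hP.hasDerivWithinAt ht) (fun t _ => ?_) ht hs
  refine (pi_norm_le_iff_of_nonneg h0).2 fun i => ?_
  exact (norm_constSpeedControl_le hδ hU (P t) i).trans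
    (Finset.single_le_sum (fun j _ => (hU j).le) (Finset.mem_univ i))

/-- The objective is nondecreasing and bounded along the trajectory, hence convergent. -/
lemma IsTrajectory.tendsto_searchObjective_sub (hQ : IsCompact Q)
    (hQc : Convex ℝ Q) (hφm : AEMeasurable φ (volume.restrict Q))
    (hφ : ∀ q ∈ Q, φ q ∈ Icc (0 : ℝ) 1) (hk : k ∈ Ioo (0 : ℝ) 1) (hα : 0 < α)
    (hδ : 0 < δ) (hU : ∀ i, 0 < U i)
    (hmass : ∀ P ∈ configSpace N Q, ∀ i, 0 < perceivedMass Q φ k α P i)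
    {P : ℝ → Robots N d} (hP : IsTrajectory (constSpeedControl Q φ k α U δ) P)
    (hP0 : P 0 ∈ configSpace N Q) (τ : ℝ) :
    Tendsto (fun t => searchObjective Q φ k α (P (t + τ)) - searchObjective Q φ k α (P t))
      atTop (𝓝 0) := by
  let h : ℝ → ℝ := fun t => searchObjective Q φ k α (P (max t 0))
  have hmono : Monotone h := by
    intro s t hst
    have := hP.mul_le_searchObjective_sub hQ hQc hφm hφ hk hα hδ hU hmass hP0
      (le_max_right s 0) (max_le_max_right 0 hst) (η := 0)
      fun r _ => gainRate_nonneg hα hU hδ (P r)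
    simp only [h]
    linarith
  have hbdd : BddAbove (range h) := by
    refine ⟨∑ _i : Fin N, volume.real Q, ?_⟩
    rintro _ ⟨t, rfl⟩
    simp only [h, searchObjective_eq_sum_perceivedMass]
    exact Finset.sum_le_sum fun i _ => perceivedMass_le hQ hφm hφ hk hα _ i
  have hlim := tendsto_atTop_ciSup hmono hbdd
  have hlim' := (hlim.comp (tendsto_atTop_add_const_right atTop τ tendsto_id)).sub hlim
  rw [sub_self] at hlim'
  refine hlim'.congr' ?_
  filter_upwards [eventually_ge_atTop 0, eventually_ge_atTop (-τ)] with t ht htτ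
  simp [h, ht, show 0 ≤ t + τ by linarith]

/-- Otherwise some sequence far from the centroidal set has moments tending to zero, and a
subsequence converges to a centroidal configuration. -/
lemma exists_le_gainRate (hQ : IsCompact Q) (hQc : Convex ℝ Q)
    (hφm : AEMeasurable φ (volume.restrict Q))
    (hφ : ∀ q ∈ Q, φ q ∈ Icc (0 : ℝ) 1) (hk : 0 < k) (hα : 0 < α) (hδ : 0 < δ)
    (hU : ∀ i, 0 < U i)
    (hmass : ∀ P ∈ configSpace N Q, ∀ i, 0 < perceivedMass Q φ k α P i) {ε : ENNReal}
    (hε : 0 < ε) :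
    ∃ η > 0, ∀ P ∈ configSpace N Q, ε ≤ Metric.infEDist P (centroidalConfigs N Q φ k α) →
      η ≤ gainRate Q φ k α U δ P := by
  by_contra! hcon
  choose x hxc hxε hxlt using fun n : ℕ => hcon (1 / ((n : ℝ) + 1)) (by positivity)
  have hgain : Tendsto (fun n => gainRate Q φ k α U δ (x n)) atTop (𝓝 0) :=
    squeeze_zero (fun n => gainRate_nonneg hα hU hδ _) (fun n => (hxlt n).le)
      tendsto_one_div_add_atTop_nhds_zero_nat
  have hD := Metric.diam_nonneg (s := Q)
  have hV : 0 ≤ volume.real Q := measureReal_nonneg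
  have hv : ∀ i, Tendsto (fun n => perceivedMoment Q φ k α (x n) i) atTop (𝓝 0) := by
    intro i
    set c := 2 * α * (U i / ((δ + Metric.diam Q) * (volume.real Q + 1))) with hc
    have hcpos : 0 < c := by
      have := hU i
      positivity
    have hle : ∀ n, c * ‖perceivedMoment Q φ k α (x n) i‖ ^ 2 ≤ gainRate Q φ k α U δ (x n) := by
      intro n
      rw [hc, mul_assoc, gainRate]
      refine mul_le_mul_of_nonneg_left ?_ (by positivity)
      refine Finset.single_le_sum (f := fun i => U i / ((δ + Metric.diam Q) *
        (volume.real Q + 1)) * ‖perceivedMoment Q φ k α (x n) i‖ ^ 2) (fun j _ => ?_)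
        (Finset.mem_univ i)
      have := (hU j).le
      positivity
    have h1 : Tendsto (fun n => c * ‖perceivedMoment Q φ k α (x n) i‖ ^ 2) atTop (𝓝 0) :=
      squeeze_zero (fun n => by positivity) hle hgain
    have h2 := (h1.const_mul c⁻¹).sqrt
    simp only [inv_mul_cancel_left₀ hcpos.ne', Real.sqrt_sq (norm_nonneg _), mul_zero,
      Real.sqrt_zero] at h2
    exact tendsto_zero_iff_norm_tendsto_zero.2 h2
  obtain ⟨P, hP, σ, -, hlim⟩ :=
    exists_tendsto_centroidalConfigs hQ hQc hφm hφ hk hmass hxc hv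
  have h1 := (Metric.continuous_infEDist (s := centroidalConfigs N Q φ k α)).tendsto P |>.comp hlim
  have h2 := ge_of_tendsto' h1 fun n => hxε (σ n)
  rw [Metric.infEDist_zero_of_mem hP] at h2
  exact absurd h2 (not_le.2 hε)

/-- At distance more than `r` the trajectory needs a fixed time to come within `r / 2`, during which
the objective gains a fixed amount; this is impossible at late times. Nonemptiness of the centroidal
set is not assumed: the distance `⊤` to an empty set is excluded by the same argument. -/
lemma IsTrajectory.tendsto_infEDist (hQ : IsCompact Q)
    (hQc : Convex ℝ Q) (hφm : AEMeasurable φ (volume.restrict Q))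
    (hφ : ∀ q ∈ Q, φ q ∈ Icc (0 : ℝ) 1) (hk : k ∈ Ioo (0 : ℝ) 1) (hα : 0 < α)
    (hδ : 0 < δ) (hU : ∀ i, 0 < U i)
    (hmass : ∀ P ∈ configSpace N Q, ∀ i, 0 < perceivedMass Q φ k α P i)
    {P : ℝ → Robots N d} (hP : IsTrajectory (constSpeedControl Q φ k α U δ) P)
    (hP0 : P 0 ∈ configSpace N Q) :
    Tendsto (fun t => Metric.infEDist (P t) (centroidalConfigs N Q φ k α)) atTop (𝓝 0) := by
  rw [ENNReal.tendsto_nhds_zero]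
  intro ε hε
  obtain ⟨r, hr, hrε⟩ := ENNReal.lt_iff_exists_nnreal_btwn.1 hε
  have hr0 : 0 < r := by exact_mod_cast hr
  obtain ⟨η, hη, hgain⟩ := exists_le_gainRate (δ := δ) (U := U) hQ hQc hφm hφ hk.1 hα hδ hU hmass
    (ε := ((r / 2 : NNReal) : ENNReal)) (by exact_mod_cast half_pos hr0)
  have hL : 0 < (∑ i, U i) + 1 := by
    have := Finset.sum_nonneg fun i (_ : i ∈ Finset.univ) => (hU i).le
    linarith
  -- At total speed at most `∑ i, U i`, the displacement during time `τ` is at most `r / 2`; the `+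
  -- 1` avoids division by zero when there are no robots.
  set τ : ℝ := (r / 2 : NNReal) / ((∑ i, U i) + 1) with hτ
  have hτ0 : 0 < τ := div_pos (by exact_mod_cast half_pos hr0) hL
  filter_upwards [eventually_ge_atTop 0, (hP.tendsto_searchObjective_sub hQ hQc hφm hφ hk hα hδ hU
    hmass hP0 τ).eventually_lt_const (mul_pos hη hτ0)] with t ht hlt
  by_contra hcon
  have hfar : (r : ENNReal) < Metric.infEDist (P t) (centroidalConfigs N Q φ k α) :=
    hrε.trans (not_le.1 hcon)
  have hrate : ∀ s ∈ Icc t (t + τ), η ≤ gainRate Q φ k α U δ (P s) := by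
    intro s hs
    have hs0 := ht.trans hs.1
    refine hgain _ (hP.mem_configSpace hQ hQc hφm hφ hk.1.le hδ hU hmass hP0 hs0) ?_
    have hd : edist (P t) (P s) ≤ ((r / 2 : NNReal) : ENNReal) := by
      rw [edist_le_coe, ← NNReal.coe_le_coe, coe_nndist]
      refine (hP.dist_le hδ hU ht hs0).trans ?_
      calc (∑ i, U i) * |t - s| ≤ ((∑ i, U i) + 1) * τ := by
            gcongr
            · linarith
            · rw [abs_sub_comm, abs_of_nonneg (by linarith [hs.1])]
              linarith [hs.2]
        _ = (r / 2 : NNReal) := by rw [hτ, mul_div_cancel₀ _ hL.ne']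
    by_contra hlt'
    have h1 : Metric.infEDist (P t) (centroidalConfigs N Q φ k α)
        < ((r / 2 : NNReal) : ENNReal) + ((r / 2 : NNReal) : ENNReal) := by
      refine (Metric.infEDist_le_infEDist_add_edist (y := P s)).trans_lt ?_
      exact ENNReal.add_lt_add_of_lt_of_le (hd.trans_lt ENNReal.coe_lt_top).ne (not_le.1 hlt') hd
    rw [← ENNReal.coe_add, add_halves] at h1
    exact absurd h1 (not_lt.2 hfar.le)
  have := hP.mul_le_searchObjective_sub hQ hQc hφm hφ hk hα hδ hU hmass hP0 ht
    (by linarith) hrate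
  rw [add_sub_cancel_left] at this
  linarith

end Convergence

theorem mainTheorem3 (N d : ℕ) (Q : Set (Pt d)) (hQ : IsConvexPolytope Q)
    (φ : Pt d → ℝ) (hφm : AEMeasurable φ (volume.restrict Q))
    (hφ : ∀ q ∈ Q, φ q ∈ Icc (0 : ℝ) 1)
    (k α : ℝ) (hk : k ∈ Ioo (0 : ℝ) 1) (hα : 0 < α)
    (hmass : ∀ P ∈ configSpace N Q, ∀ i, 0 < perceivedMass Q φ k α P i)
    (U : Fin N → ℝ) (hU : ∀ i, 0 < U i) (δ : ℝ) (hδ : 0 < δ) :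
    criticalConfigs Q (searchObjective (N := N) Q φ k α) = centroidalConfigs N Q φ k α ∧
    ∀ P : ℝ → Robots N d, P 0 ∈ configSpace N Q →
      IsTrajectory (constSpeedControl Q φ k α U δ) P →
      Tendsto (fun t => Metric.infEDist (P t) (criticalConfigs Q (searchObjective Q φ k α)))
        atTop (𝓝 0) := by
  have hQk := isCompact_of_isConvexPolytope hQ
  have hQc : Convex ℝ Q := by
    obtain ⟨s, rfl⟩ := hQ
    exact convex_convexHull ℝ _
  have hcrit := criticalConfigs_eq hQk hφm hφ hk hα hmass
  refine ⟨hcrit, fun P hP0 hP => ?_⟩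
  rw [hcrit]
  exact hP.tendsto_infEDist hQk hQc hφm hφ hk hα hδ hU hmass hP0
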